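/- Let $\nu>0$, $\varepsilon>0$, and let $\rho\in C^\infty(\mathbb R^3)$ be a nonnegative, even, compactly supported function with $\int_{\mathbb R^3}\rho=1$. Put $\rho_\varepsilon(x)=\varepsilon^{-3}\rho(x/\varepsilon)$ and $\overline U=\rho_\varepsilon\star U$ for $U\in L^1_{\mathrm{loc}}(\mathbb R^3)$. Let $A\in C_b(\mathbb R_+,L^\infty(\mathbb R^3))$ with $A\ge 0$, let $u_0\in L^2(\mathbb R^3)^3$ with $\operatorname{div}u_0=0$ in the sense of distributions, and let $0<T\le\infty$. Consider the regularized Navier–Stokes equations $$\partial_t u+\overline u\cdot\nabla u-\nu\Delta u-\operatorname{div}\bigl(\overline{A\nabla\overline u}\bigr)+\nabla p=0,\qquad \operatorname{div}u=0,\qquad u|_{t=0}=\overline{u_0}.$$ A pair $(u,p)$ is a *regular solution* over $[0,T[$ if $u(0,\cdot)=\overline{u_0}$ and (i) $u,\partial_t u,\nabla u,D^2u,p,\nabla p$ exist and are continuous on $]0,T[\times\mathbb R^3$, and the first two equations hold at every point of $]0,T[\times\mathbb R^3$; (ii) $u\in L^\infty([0,\tau],L^2(\mathbb R^3)^3)\cap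 L^\infty([0,\tau]\times\mathbb R^3)^3$ for every $0<\tau<T$; (iii) $u(t,\cdot)\to\overline{u_0}$ uniformly on $\mathbb R^3$ and in $H^1(\mathbb R^3)^3$ as $t\to0^+$. **Theorem.** The regularized Navier–Stokes equations have at most one regular solution over $[0,T[$, the pressure being determined up to the addition of a function of time alone. That is, if $(u_1,p_1)$ and $(u_2,p_2)$ are regular solutions over $[0,T[$ with the same data, then $u_1=u_2$ on $[0,T[\times\mathbb R^3$, and for every $t\in{]0,T[}$ the difference $p_1(t,\cdot)-p_2(t,\cdot)$ is constant on $\mathbb R^3$. Moreover, for every $t\in{]0,T[}$ for which $p_1(t,\cdot)$ and $p_2(t,\cdot)$ both belong to $L^2(\mathbb R^3)$, one has $p_1(t,\cdot)=p_2(t,\cdot)$. -/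

import Mathlib

open MeasureTheory Filter Topology
open scoped ENNReal ContDiff

noncomputable section

namespace RegNSE

/-- Three dimensional Euclidean space. -/
abbrev E3 : Type := EuclideanSpace ℝ (Fin 3)

/-- The partial derivative `∂ f / ∂ x_j` of a function on `ℝ³`. -/
def partialD {F : Type*} [NormedAddCommGroup F] [NormedSpace ℝ F]
    (j : Fin 3) (f : E3 → F) (x : E3) : F :=
  fderiv ℝ f x (EuclideanSpace.single j (1 : ℝ))

/-- The divergence `∑ j, ∂ v_j / ∂ x_j` of a vector field on `ℝ³`. -/
def divergence (v : E3 → E3) (x : E3) : ℝ := ∑ j : Fin 3, (partialD j v x) j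

/-- A mollifier: smooth, nonnegative, even, with compact support and integral one. -/
structure IsMollifier (ρ : E3 → ℝ) : Prop where
  smooth : ContDiff ℝ ∞ ρ
  nonneg : ∀ x, 0 ≤ ρ x
  compactSupport : HasCompactSupport ρ
  integral_eq_one : ∫ x, ρ x = 1
  even : ∀ x, ρ (-x) = ρ x

/-- The rescaled mollifier `ρ_ε (x) = ε⁻³ ρ (x / ε)`. -/
def rescale (ρ : E3 → ℝ) (ε : ℝ) (x : E3) : ℝ := (ε ^ 3)⁻¹ * ρ (ε⁻¹ • x)

/-- The regularization `ρ_ε ⋆ U`, the integral of `ρ_ε (x - y) U (y)` over `y ∈ ℝ³`. -/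
def mollify {F : Type*} [NormedAddCommGroup F] [NormedSpace ℝ F]
    (ρ : E3 → ℝ) (ε : ℝ) (U : E3 → F) (x : E3) : F :=
  ∫ y, rescale ρ ε (x - y) • U y

/-- `div v = 0` in the sense of distributions. -/
def WeakDivFree (v : E3 → E3) : Prop :=
  ∀ φ : E3 → ℝ, ContDiff ℝ ∞ φ → HasCompactSupport φ →
    ∫ x, inner ℝ (v x) (gradient φ x) = 0

/-- The open time interval `]0, T[`, where `T = ∞` is allowed. -/
def openTime (T : EReal) : Set ℝ := {t : ℝ | 0 < t ∧ (t : EReal) < T}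

/-- The convection term `w · ∇ v`, with components `∑ j, w_j ∂_j v_i`. -/
def convection (w v : E3 → E3) (x : E3) : E3 := ∑ j : Fin 3, (w x) j • partialD j v x

/-- The regularized eddy viscosity term: the divergence of the regularization of `a ∇ v̄`, where
`v̄` is the regularization of `v`. The `i`-th component is `∑ j, ∂_j (ρ_ε ⋆ (a ∂_j v̄_i))`. -/
def eddyTerm (ρ : E3 → ℝ) (ε : ℝ) (a : E3 → ℝ) (v : E3 → E3) (x : E3) : E3 :=
  ∑ j : Fin 3, partialD j (mollify ρ ε (fun y => a y • partialD j (mollify ρ ε v) y)) x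

/-- `(u, p)` is a regular solution over `[0, T[` of the regularized Navier-Stokes equations with
viscosity `ν`, eddy viscosity `A`, mollifier `ρ`, regularization parameter `ε` and initial datum
the regularization of `u₀`. The values of `u` and `p` at times outside `[0, T[`, and the value of
`p` at time `0`, are irrelevant. -/
structure IsRegularSolution (ν : ℝ) (A : ℝ → Lp ℝ ∞ (volume : Measure E3))
    (ρ : E3 → ℝ) (ε : ℝ) (u₀ : E3 → E3) (T : EReal)
    (u : ℝ → E3 → E3) (p : ℝ → E3 → ℝ) : Prop where
  /-- `u`, `∂_t u`, `∇ u`, `D² u` exist and are continuous on `]0, T[ × ℝ³`. -/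
  continuousOn_u :
    ContinuousOn (fun z : ℝ × E3 => u z.1 z.2) (openTime T ×ˢ Set.univ)
  differentiableAt_time :
    ∀ t ∈ openTime T, ∀ x : E3, DifferentiableAt ℝ (fun s : ℝ => u s x) t
  continuousOn_time_deriv :
    ContinuousOn (fun z : ℝ × E3 => deriv (fun s : ℝ => u s z.2) z.1) (openTime T ×ˢ Set.univ)
  contDiff_u : ∀ t ∈ openTime T, ContDiff ℝ 2 (u t)
  continuousOn_grad_u :
    ContinuousOn (fun z : ℝ × E3 => fderiv ℝ (u z.1) z.2) (openTime T ×ˢ Set.univ)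
  continuousOn_hess_u :
    ContinuousOn (fun z : ℝ × E3 => fderiv ℝ (fderiv ℝ (u z.1)) z.2) (openTime T ×ˢ Set.univ)
  /-- `p`, `∇ p` exist and are continuous on `]0, T[ × ℝ³`. -/
  continuousOn_p :
    ContinuousOn (fun z : ℝ × E3 => p z.1 z.2) (openTime T ×ˢ Set.univ)
  contDiff_p : ∀ t ∈ openTime T, ContDiff ℝ 1 (p t)
  continuousOn_grad_p :
    ContinuousOn (fun z : ℝ × E3 => gradient (p z.1) z.2) (openTime T ×ˢ Set.univ)
  /-- The momentum equation. -/
  momentum : ∀ t ∈ openTime T, ∀ x : E3,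
    deriv (fun s : ℝ => u s x) t + convection (mollify ρ ε (u t)) (u t) x
      - ν • Laplacian.laplacian (u t) x - eddyTerm ρ ε (A t) (u t) x + gradient (p t) x = 0
  /-- Incompressibility. -/
  incompressible : ∀ t ∈ openTime T, ∀ x : E3, divergence (u t) x = 0
  /-- For all `τ < T`, `u` belongs to `L^∞([0, τ], L²)`. -/
  bounded_L2 : ∀ τ ∈ openTime T, ∃ C : ℝ,
    ∀ᵐ t ∂(volume.restrict (Set.Icc (0 : ℝ) τ)),
      eLpNorm (u t) 2 (volume : Measure E3) ≤ ENNReal.ofReal C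
  /-- For all `τ < T`, `u` belongs to `L^∞([0, τ] × ℝ³)`. -/
  bounded_Linfty : ∀ τ ∈ openTime T,
    MemLp (fun z : ℝ × E3 => u z.1 z.2) ∞
      ((volume : Measure (ℝ × E3)).restrict (Set.Icc (0 : ℝ) τ ×ˢ Set.univ))
  /-- The initial datum. -/
  initial : u 0 = mollify ρ ε u₀
  /-- As `t → 0⁺`, `u(t, ·)` converges to the initial datum uniformly and in `H¹`. -/
  initial_uniform : TendstoUniformly u (mollify ρ ε u₀) (𝓝[>] (0 : ℝ))
  initial_L2 :
    Tendsto (fun t : ℝ => eLpNorm (fun x => u t x - mollify ρ ε u₀ x) 2 (volume : Measure E3))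
      (𝓝[>] (0 : ℝ)) (𝓝 0)
  initial_grad_L2 :
    Tendsto (fun t : ℝ => eLpNorm (fun x => fderiv ℝ (u t) x - fderiv ℝ (mollify ρ ε u₀) x) 2
      (volume : Measure E3)) (𝓝[>] (0 : ℝ)) (𝓝 0)

end RegNSE

end

section

open scoped SchwartzMap FourierTransform LineDeriv Laplacian

/-! Let `w` be the difference of the two velocities. The definition of a regular solution gives no
integrability in space of the gradients or of the pressure at positive times, so an energy identity
for `w` is not directly available. The proof works with a weak formulation instead and needs only
`L²` and `L^∞` bounds on the velocities.

Test fields `curl curl (ζ e_a)` with `ζ` compactly supported are divergence free, so the pressure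
drops out whatever its growth. Since `curl curl = ∇ div - Δ` and `div w = 0`, they see only `⟨w_a,
Δζ⟩`. Written in divergence form, the nonlinear terms depend on the velocity in a Lipschitz way in
`L²` (`eLpNorm_flux_sub_le`). Hence `d/ds ⟨w_a, Δζ⟩ = ν⟨w_a, Δ²ζ⟩ - R`, with `|R|` at most `K ‖w‖₂`
times the `L²` norms of the first derivatives of the test field (`IsWeakEvolution`,
`exists_isWeakEvolution_sub`).

The function `ζ` is then moved along the backward heat flow, which cancels the viscous term.
Parabolic smoothing bounds the extra derivative by `(ν(t-s))^{-1/2}`, an integrable singularity, so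
`‖w(t)‖₂ ≤ 3(‖w(s₀)‖₂ + c √(t-s₀) sup ‖w‖₂)` (`norm_pairing_le_duhamel`, `l2norm_le_duhamel`). On
short intervals this bound halves itself repeatedly, so `w` vanishes there; intervals of a fixed
length then cover all times (`l2norm_eq_zero`).

Once the velocities agree, the momentum equations give equal pressure gradients. The pressures then
differ by a constant, and a nonzero constant is not in `L²(ℝ³)`. -/

namespace RegNSE

/-! ### Density of compactly supported functions in the Schwartz space -/

section Density

variable {F : Type*} [NormedAddCommGroup F] [NormedSpace ℝ F]

/-- Cutting off a Schwartz function far from the origin changes it little in the Schwartz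
topology. -/
theorem exists_seminorm_cutoff_sub_le {χ : E3 → ℝ} (hχ : ContDiff ℝ ∞ χ)
    (hc : HasCompactSupport χ) (h1 : ∀ x, ‖x‖ ≤ 1 → χ x = 1) (ζ : 𝓢(E3, F)) (k m : ℕ) :
    ∃ C : ℝ, 0 ≤ C ∧ ∀ n : ℕ, 1 ≤ n → ∀ x : E3,
      ‖x‖ ^ k * ‖iteratedFDeriv ℝ m (fun y => (1 - χ ((n : ℝ)⁻¹ • y)) • ζ y) x‖ ≤ C * (n : ℝ)⁻¹ := by
  set X : E3 → ℝ := fun y => 1 - χ y with hX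
  have hXs : ContDiff ℝ ∞ X := contDiff_const.sub hχ
  have hXb : ∀ i : ℕ, ∃ D : ℝ, 0 ≤ D ∧ ∀ x, ‖iteratedFDeriv ℝ i X x‖ ≤ D := by
    intro i
    have hcont : Continuous (fun x => iteratedFDeriv ℝ i χ x) :=
      (hχ.of_le (mod_cast le_top)).continuous_iteratedFDeriv'
    obtain ⟨D, hD⟩ := hcont.bounded_above_of_compact_support (hc.iteratedFDeriv i)
    refine ⟨|D| + 1, by positivity, fun x => ?_⟩
    have h2 := hD x
    have h3 := le_abs_self D
    rcases Nat.eq_zero_or_pos i with rfl | hi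
    · rw [norm_iteratedFDeriv_zero] at h2 ⊢
      calc ‖X x‖ ≤ ‖(1 : ℝ)‖ + ‖χ x‖ := norm_sub_le _ _
        _ ≤ _ := by rw [norm_one]; linarith
    · have : iteratedFDeriv ℝ i X x = - iteratedFDeriv ℝ i χ x := by
        have h4 : X = (fun _ => (1 : ℝ)) - χ := rfl
        rw [h4, iteratedFDeriv_sub_apply (contDiff_const.contDiffAt)
          ((hχ.of_le (mod_cast le_top)).contDiffAt), iteratedFDeriv_const_of_ne hi.ne']
        simp
      rw [this, norm_neg]
      linarith
  choose D hD0 hD using hXb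
  refine ⟨∑ i ∈ Finset.range (m + 1), (m.choose i : ℝ) * D i *
    SchwartzMap.seminorm ℝ (k + 1) (m - i) ζ, ?_, fun n hn x => ?_⟩
  · exact Finset.sum_nonneg fun i _ =>
      mul_nonneg (mul_nonneg (Nat.cast_nonneg _) (hD0 i)) (apply_nonneg _ _)
  have hn0 : (0 : ℝ) < n := by exact_mod_cast hn
  have hn1 : (n : ℝ)⁻¹ ≤ 1 := inv_le_one_of_one_le₀ (by exact_mod_cast hn)
  -- Inside the ball the function vanishes near `x`. Outside, `n ≤ ‖x‖`, so raising the weight from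
  -- `k` to `k + 1` pays for the factor `n⁻¹`.
  by_cases hx : ‖x‖ < n
  · have hz : (fun y => (1 - χ ((n : ℝ)⁻¹ • y)) • ζ y) =ᶠ[𝓝 x] fun _ => (0 : F) := by
      have : ∀ᶠ y in 𝓝 x, ‖y‖ < n := (continuous_norm.continuousAt).eventually_lt
        continuousAt_const hx
      filter_upwards [this] with y hy
      rw [h1, sub_self, zero_smul]
      rw [norm_smul, norm_inv, Real.norm_natCast, inv_mul_le_one₀ hn0]
      exact hy.le
    rw [(hz.iteratedFDeriv (𝕜 := ℝ) m).eq_of_nhds]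
    have : iteratedFDeriv ℝ m (fun _ : E3 => (0 : F)) x = 0 := by
      simp
    rw [this, norm_zero, mul_zero]
    exact mul_nonneg (Finset.sum_nonneg fun i _ =>
      mul_nonneg (mul_nonneg (Nat.cast_nonneg _) (hD0 i)) (apply_nonneg _ _)) (by positivity)
  · push Not at hx
    have hle := norm_iteratedFDeriv_smul_le (𝕜 := ℝ) (𝕜' := ℝ) (f := fun y => X ((n : ℝ)⁻¹ • y))
      (g := ζ) (N := ∞)
      (hXs.comp (contDiff_const_smul _)) (ζ.smooth ⊤) x (n := m) (mod_cast le_top)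
    calc ‖x‖ ^ k * ‖iteratedFDeriv ℝ m (fun y => (1 - χ ((n : ℝ)⁻¹ • y)) • ζ y) x‖
        ≤ ‖x‖ ^ k * ∑ i ∈ Finset.range (m + 1), (m.choose i : ℝ) *
          ‖iteratedFDeriv ℝ i (fun y => X ((n : ℝ)⁻¹ • y)) x‖ *
          ‖iteratedFDeriv ℝ (m - i) ζ x‖ := by gcongr
      _ ≤ _ := by
        rw [Finset.mul_sum, Finset.sum_mul]
        refine Finset.sum_le_sum fun i _ => ?_
        have e1 : ‖iteratedFDeriv ℝ i (fun y => X ((n : ℝ)⁻¹ • y)) x‖ ≤ D i := by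
          rw [iteratedFDeriv_comp_const_smul _ (hXs.of_le (mod_cast le_top))]
          rw [norm_smul, norm_pow, norm_inv, Real.norm_natCast]
          calc _ ≤ 1 * D i := by
                gcongr
                · exact pow_le_one₀ (by positivity) hn1
                · exact hD i _
            _ = D i := one_mul _
        have e2 : ‖x‖ ^ k * ‖iteratedFDeriv ℝ (m - i) ζ x‖ ≤
            SchwartzMap.seminorm ℝ (k + 1) (m - i) ζ * (n : ℝ)⁻¹ := by
          rw [← div_eq_mul_inv, le_div_iff₀ hn0]
          calc ‖x‖ ^ k * ‖iteratedFDeriv ℝ (m - i) ζ x‖ * n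
              ≤ ‖x‖ ^ k * ‖iteratedFDeriv ℝ (m - i) ζ x‖ * ‖x‖ := by gcongr
            _ = ‖x‖ ^ (k + 1) * ‖iteratedFDeriv ℝ (m - i) ζ x‖ := by ring
            _ ≤ _ := SchwartzMap.le_seminorm ℝ _ _ ζ x
        calc ‖x‖ ^ k * ((m.choose i : ℝ) *
            ‖iteratedFDeriv ℝ i (fun y => X ((n : ℝ)⁻¹ • y)) x‖ * ‖iteratedFDeriv ℝ (m - i) ζ x‖)
            = (m.choose i : ℝ) * ‖iteratedFDeriv ℝ i (fun y => X ((n : ℝ)⁻¹ • y)) x‖ *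
              (‖x‖ ^ k * ‖iteratedFDeriv ℝ (m - i) ζ x‖) := by ring
          _ ≤ (m.choose i : ℝ) * D i * (SchwartzMap.seminorm ℝ (k + 1) (m - i) ζ * (n : ℝ)⁻¹) := by
            gcongr
            exact mul_nonneg (Nat.cast_nonneg _) (hD0 i)
          _ = _ := by ring

/-- Compactly supported functions are dense in the Schwartz space. -/
theorem dense_hasCompactSupport_schwartz :
    Dense {ζ : 𝓢(E3, F) | HasCompactSupport ζ} := by
  let b : ContDiffBump (0 : E3) := ⟨1, 2, one_pos, one_lt_two⟩
  have hb1 : ∀ x, ‖x‖ ≤ 1 → b x = 1 := fun x hx =>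
    b.one_of_mem_closedBall (by simpa [b] using hx)
  intro ζ
  have hcs : ∀ n : ℕ, 1 ≤ n →
      HasCompactSupport (fun y : E3 => b ((n : ℝ)⁻¹ • y) • ζ y) := fun n hn => by
    have hn0 : ((n : ℝ)⁻¹) ≠ 0 := by positivity
    exact (b.hasCompactSupport.comp_smul hn0).smul_right
  have hsm : ∀ n : ℕ, ContDiff ℝ ∞ (fun y : E3 => b ((n : ℝ)⁻¹ • y) • ζ y) := fun n =>
    (b.contDiff.comp (contDiff_const_smul _)).smul (ζ.smooth ⊤)
  -- The shift to `n + 1` keeps the dilation factor nonzero.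
  let ζn : ℕ → 𝓢(E3, F) := fun n => (hcs (n + 1) (by omega)).toSchwartzMap (hsm (n + 1))
  have hζn : ∀ n x, ζn n x = b (((n + 1 : ℕ) : ℝ)⁻¹ • x) • ζ x := fun n x => rfl
  refine mem_closure_of_tendsto (f := ζn) (b := atTop) ?_ (Eventually.of_forall fun n =>
    hcs (n + 1) (by omega))
  rw [(schwartz_withSeminorms ℝ E3 F).tendsto_nhds]
  rintro ⟨k, m⟩ δ hδ
  obtain ⟨C, hC0, hC⟩ := exists_seminorm_cutoff_sub_le b.contDiff b.hasCompactSupport hb1 ζ k m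
  have hlim : Tendsto (fun n : ℕ => C * ((n + 1 : ℕ) : ℝ)⁻¹) atTop (𝓝 0) := by
    have h := (tendsto_one_div_add_atTop_nhds_zero_nat (𝕜 := ℝ)).const_mul C
    simpa [mul_zero] using h
  filter_upwards [hlim.eventually_lt_const hδ] with n hn
  refine lt_of_le_of_lt ?_ hn
  rw [SchwartzMap.schwartzSeminormFamily_apply]
  refine SchwartzMap.seminorm_le_bound ℝ k m _ (by positivity) fun x => ?_
  have : ((ζn n - ζ : 𝓢(E3, F)) : E3 → F) =
      -(fun y => (1 - b (((n + 1 : ℕ) : ℝ)⁻¹ • y)) • ζ y) := by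
    ext y
    rw [sub_apply, hζn, Pi.neg_apply, sub_smul, one_smul, neg_sub]
  rw [this, iteratedFDeriv_neg_apply, norm_neg]
  exact hC (n + 1) (by omega) x

end Density

end RegNSE

/-! ### Solenoidal test fields and weak evolutions -/

namespace RegNSE

noncomputable section

/-- The standard basis vector of `ℝ³`. -/
abbrev basisVec (j : Fin 3) : E3 := EuclideanSpace.single j (1 : ℝ)

/-- The divergence free field `curl curl (ζ e_a)`, with components `∂_i ∂_a ζ - δ_{ia} Δ ζ`. -/
def curlCurl (a : Fin 3) (ζ : 𝓢(E3, ℂ)) (i : Fin 3) : 𝓢(E3, ℂ) :=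
  ∂_{basisVec i} (∂_{basisVec a} ζ) - if i = a then Δ ζ else 0

/-- The sum of the `L²` norms of the first derivatives of `curl curl (ζ e_a)`. -/
def gradCurlCurlNorm (a : Fin 3) (ζ : 𝓢(E3, ℂ)) : ℝ :=
  ∑ i : Fin 3, ∑ j : Fin 3, ‖(∂_{basisVec j} (curlCurl a ζ i)).toLp 2‖

/-- The integral of the product of a real function with a complex Schwartz function. -/
def pairing (f : E3 → ℝ) (ζ : 𝓢(E3, ℂ)) : ℂ := ∫ x, f x • ζ x

/-- The `L²` norm as a real number. -/
def l2norm {F : Type*} [NormedAddCommGroup F] (f : E3 → F) : ℝ :=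
  (eLpNorm f 2 (volume : Measure E3)).toReal

lemma l2norm_nonneg {F : Type*} [NormedAddCommGroup F] (f : E3 → F) : 0 ≤ l2norm f :=
  ENNReal.toReal_nonneg

lemma integrable_smul_schwartz {f : E3 → ℝ} (hf : MemLp f 2) (ζ : 𝓢(E3, ℂ)) :
    Integrable (fun x => f x • ζ x) :=
  memLp_one_iff_integrable.1 ((ζ.memLp 2).smul hf)

lemma norm_integral_smul_le {f : E3 → ℝ} {g : E3 → ℂ} (hf : MemLp f 2) (hg : MemLp g 2) :
    ‖∫ x, (f • g) x‖ ≤ l2norm f * l2norm g := by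
  have h1 : eLpNorm (f • g) 1 (volume : Measure E3) ≤
      eLpNorm f 2 (volume : Measure E3) * eLpNorm g 2 (volume : Measure E3) :=
    eLpNorm_smul_le_mul_eLpNorm hg.1 hf.1
  have h2 : Integrable (f • g) := memLp_one_iff_integrable.1 (hg.smul hf)
  have h3 : ∫ x, ‖(f • g) x‖ = (eLpNorm (f • g) 1 (volume : Measure E3)).toReal := by
    rw [eLpNorm_one_eq_lintegral_enorm, integral_norm_eq_lintegral_enorm h2.1]
  have h4 := ENNReal.toReal_mono (ENNReal.mul_ne_top hf.2.ne hg.2.ne) h1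
  rw [ENNReal.toReal_mul, ← h3] at h4
  exact (norm_integral_le_integral_norm _).trans h4

lemma norm_pairing_le {f : E3 → ℝ} (hf : MemLp f 2) (ζ : 𝓢(E3, ℂ)) :
    ‖pairing f ζ‖ ≤ l2norm f * ‖ζ.toLp 2‖ := by
  rw [SchwartzMap.norm_toLp]
  exact norm_integral_smul_le hf (ζ.memLp 2)

lemma pairing_add {f : E3 → ℝ} (hf : MemLp f 2) (ζ η : 𝓢(E3, ℂ)) :
    pairing f (ζ + η) = pairing f ζ + pairing f η := by
  rw [pairing, pairing, pairing,
    ← integral_add (integrable_smul_schwartz hf ζ) (integrable_smul_schwartz hf η)]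
  simp [smul_add]

lemma pairing_smul (f : E3 → ℝ) (c : ℂ) (ζ : 𝓢(E3, ℂ)) :
    pairing f (c • ζ) = c * pairing f ζ := by
  rw [pairing, pairing, ← integral_const_mul]
  refine integral_congr_ae (Eventually.of_forall fun x => ?_)
  simp only [smul_apply, Complex.real_smul, smul_eq_mul]
  ring

lemma pairing_sub {f : E3 → ℝ} (hf : MemLp f 2) (ζ η : 𝓢(E3, ℂ)) :
    pairing f (ζ - η) = pairing f ζ - pairing f η := by
  rw [pairing, pairing, pairing,
    ← integral_sub (integrable_smul_schwartz hf ζ) (integrable_smul_schwartz hf η)]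
  simp [smul_sub]

lemma continuous_pairing {f : E3 → ℝ} (hf : MemLp f 2) : Continuous (pairing f) := by
  refine continuous_iff_continuousAt.2 fun ζ => ?_
  rw [ContinuousAt, tendsto_iff_norm_sub_tendsto_zero]
  have h : Tendsto (fun η : 𝓢(E3, ℂ) => l2norm f * ‖(η - ζ).toLp 2‖) (𝓝 ζ) (𝓝 0) := by
    have : Continuous fun η : 𝓢(E3, ℂ) => l2norm f * ‖(η - ζ).toLp 2‖ :=
      continuous_const.mul
        ((SchwartzMap.continuous_toLp (p := 2)).comp (continuous_id.sub continuous_const)).norm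
    have h0 : l2norm f * ‖(ζ - ζ).toLp 2‖ = 0 := by
      rw [sub_self, SchwartzMap.norm_toLp]
      have : ((0 : 𝓢(E3, ℂ)) : E3 → ℂ) = 0 := rfl
      simp [this]
    have h2 := this.tendsto ζ
    rwa [h0] at h2
  refine squeeze_zero (fun _ => norm_nonneg _) (fun η => ?_) h
  rw [← pairing_sub hf]
  exact norm_pairing_le hf _

lemma memLp_coord {v : E3 → E3} {p : ℝ≥0∞} (hv : MemLp v p) (a : Fin 3) :
    MemLp (fun x => v x a) p :=
  (EuclideanSpace.proj (𝕜 := ℝ) a : E3 →L[ℝ] ℝ).comp_memLp' hv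

lemma eLpNorm_coord_le (v : E3 → E3) (p : ℝ≥0∞) (a : Fin 3) :
    eLpNorm (fun x => v x a) p (volume : Measure E3) ≤ eLpNorm v p (volume : Measure E3) :=
  eLpNorm_mono fun x => PiLp.norm_apply_le (v x) a

lemma l2norm_coord_le {v : E3 → E3} (hv : MemLp v 2) (a : Fin 3) :
    l2norm (fun x => v x a) ≤ l2norm v :=
  ENNReal.toReal_mono hv.2.ne (eLpNorm_coord_le v 2 a)

lemma continuous_laplacian_schwartz : Continuous fun ζ : 𝓢(E3, ℂ) => Δ ζ :=
  (LineDeriv.laplacianCLM ℝ E3 𝓢(E3, ℂ)).continuous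

lemma continuous_curlCurl (a i : Fin 3) : Continuous fun ζ => curlCurl a ζ i := by
  unfold curlCurl
  have h : Continuous fun ζ : 𝓢(E3, ℂ) => (∂_{basisVec i} (∂_{basisVec a} ζ) : 𝓢(E3, ℂ)) :=
    (ContinuousLineDeriv.continuous_lineDerivOp _).comp
      (ContinuousLineDeriv.continuous_lineDerivOp _)
  refine h.sub ?_
  by_cases hi : i = a
  · simpa only [hi, if_true] using continuous_laplacian_schwartz
  · simpa only [hi, if_false] using continuous_const

lemma continuous_gradCurlCurlNorm (a : Fin 3) : Continuous (gradCurlCurlNorm a) := by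
  unfold gradCurlCurlNorm
  refine continuous_finsetSum _ fun i _ => continuous_finsetSum _ fun j _ => ?_
  exact ((SchwartzMap.continuous_toLp (p := 2)).comp
    ((ContinuousLineDeriv.continuous_lineDerivOp _).comp (continuous_curlCurl a i))).norm

lemma gradCurlCurlNorm_nonneg (a : Fin 3) (ζ : 𝓢(E3, ℂ)) : 0 ≤ gradCurlCurlNorm a ζ :=
  Finset.sum_nonneg fun _ _ => Finset.sum_nonneg fun _ _ => norm_nonneg _

/-- The weak form, tested against the fields `curl curl (ζ e_a)`, of a heat equation with a forcing
term which is the divergence of a tensor controlled in `L²` by the solution, on `]0, τ[`. -/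
structure IsWeakEvolution (ν K τ : ℝ) (w : ℝ → E3 → E3) : Prop where
  memLp : ∀ s ∈ Set.Ioo 0 τ, MemLp (w s) 2
  hasDerivAt : ∀ s ∈ Set.Ioo 0 τ, ∀ (a : Fin 3) (ζ : 𝓢(E3, ℂ)), HasCompactSupport ζ →
    ∃ R : ℂ, ‖R‖ ≤ K * l2norm (w s) * gradCurlCurlNorm a ζ ∧
      HasDerivAt (fun r => pairing (fun x => w r x a) (Δ ζ))
        (ν * pairing (fun x => w s x a) (Δ (Δ ζ)) - R) s

lemma hasCompactSupport_laplacian {ζ : 𝓢(E3, ℂ)} (h : HasCompactSupport ζ) :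
    HasCompactSupport (Δ ζ : 𝓢(E3, ℂ)) := by
  rw [SchwartzMap.laplacian_eq_sum (EuclideanSpace.basisFun (Fin 3) ℝ)]
  refine h.mono' ?_
  intro x hx
  by_contra hx'
  apply hx
  rw [sum_apply]
  refine Finset.sum_eq_zero fun i _ => ?_
  by_contra hne
  exact hx' ((SchwartzMap.tsupport_lineDerivOp_subset _ _).trans
    (SchwartzMap.tsupport_lineDerivOp_subset _ _) (subset_tsupport _ hne))

/-- The time Lipschitz constant of the pairing of a weak evolution with `Δ ζ`. -/
def lipConst (ν K M : ℝ) (a : Fin 3) (ζ : 𝓢(E3, ℂ)) : ℝ :=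
  ν * (M * ‖(Δ (Δ ζ) : 𝓢(E3, ℂ)).toLp 2‖) + K * M * gradCurlCurlNorm a ζ

lemma continuous_lipConst (ν K M : ℝ) (a : Fin 3) : Continuous (lipConst ν K M a) := by
  unfold lipConst
  refine (continuous_const.mul (continuous_const.mul ?_)).add
    (continuous_const.mul (continuous_gradCurlCurlNorm a))
  exact ((SchwartzMap.continuous_toLp (p := 2)).comp
    (continuous_laplacian_schwartz.comp continuous_laplacian_schwartz)).norm

lemma lipConst_nonneg {ν K M : ℝ} (hν : 0 ≤ ν) (hK : 0 ≤ K) (hM : 0 ≤ M) (a : Fin 3)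
    (ζ : 𝓢(E3, ℂ)) : 0 ≤ lipConst ν K M a ζ := by
  have := gradCurlCurlNorm_nonneg a ζ
  unfold lipConst
  positivity

/-- An inequality between continuous functionals on the Schwartz space may be checked on compactly
supported functions. -/
lemma le_of_forall_hasCompactSupport {f g : 𝓢(E3, ℂ) → ℝ} (hf : Continuous f) (hg : Continuous g)
    (h : ∀ ζ : 𝓢(E3, ℂ), HasCompactSupport ζ → f ζ ≤ g ζ) (ζ : 𝓢(E3, ℂ)) : f ζ ≤ g ζ :=
  (isClosed_le hf hg).closure_subset_iff.2 h (dense_hasCompactSupport_schwartz ζ)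

namespace IsWeakEvolution

variable {ν K τ : ℝ} {w : ℝ → E3 → E3}

lemma norm_pairing_le_of_le (h : IsWeakEvolution ν K τ w) {s M : ℝ} (hs : s ∈ Set.Ioo 0 τ)
    (hM : l2norm (w s) ≤ M) (a : Fin 3) (ζ : 𝓢(E3, ℂ)) :
    ‖pairing (fun x => w s x a) ζ‖ ≤ M * ‖ζ.toLp 2‖ :=
  (norm_pairing_le (memLp_coord (h.memLp s hs) a) ζ).trans
    (mul_le_mul_of_nonneg_right ((l2norm_coord_le (h.memLp s hs) a).trans hM) (norm_nonneg _))

/-- Mean value inequality for compactly supported `ζ`. Both sides are continuous in the Schwartz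
topology, so density extends it to every `ζ`. The extension is essential: the heat flow does not
preserve compact support. -/
lemma norm_pairing_sub_le (h : IsWeakEvolution ν K τ w) (hν : 0 ≤ ν) (hK : 0 ≤ K)
    {s₀ t M : ℝ} (hs₀ : 0 < s₀) (ht : t < τ)
    (hM : ∀ r ∈ Set.Icc s₀ t, l2norm (w r) ≤ M) (a : Fin 3) (ζ : 𝓢(E3, ℂ))
    {r s : ℝ} (hr : r ∈ Set.Icc s₀ t) (hs : s ∈ Set.Icc s₀ t) :
    ‖pairing (fun x => w r x a) (Δ ζ) - pairing (fun x => w s x a) (Δ ζ)‖ ≤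
      lipConst ν K M a ζ * |r - s| := by
  have hmem : ∀ r ∈ Set.Icc s₀ t, r ∈ Set.Ioo 0 τ := fun r hr =>
    ⟨hs₀.trans_le hr.1, hr.2.trans_lt ht⟩
  have hcp : ∀ r ∈ Set.Icc s₀ t, Continuous (pairing (fun x => w r x a)) := fun r hr =>
    continuous_pairing (memLp_coord (h.memLp r (hmem r hr)) a)
  have hcl := continuous_laplacian_schwartz
  revert ζ
  refine le_of_forall_hasCompactSupport
    (((hcp r hr).comp hcl).sub ((hcp s hs).comp hcl)).norm
    ((continuous_lipConst ν K M a).mul continuous_const) fun ζ hζ => ?_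
  choose! R hR hd using fun s (hs : s ∈ Set.Icc s₀ t) => h.hasDerivAt s (hmem s hs) a ζ hζ
  have hG := gradCurlCurlNorm_nonneg a ζ
  refine Convex.norm_image_sub_le_of_norm_hasDerivWithin_le (𝕜 := ℝ)
    (f := fun r => pairing (fun x => w r x a) (Δ ζ)) (C := lipConst ν K M a ζ)
    (fun x hx => (hd x hx).hasDerivWithinAt) (fun x hx => ?_) (convex_Icc s₀ t) hs hr
  refine (norm_sub_le _ _).trans (add_le_add ?_ ((hR x hx).trans ?_))
  · rw [norm_mul, Complex.norm_real, Real.norm_of_nonneg hν]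
    exact mul_le_mul_of_nonneg_left
      (h.norm_pairing_le_of_le (hmem x hx) (hM x hx) a _) hν
  · have := hM x hx
    gcongr

/-- First order expansion in time, with the viscous term frozen at `s` and the forcing merely
bounded. It is an inequality between increments, not a statement about derivatives, so that it
survives the passage from compactly supported to Schwartz `ζ`. -/
lemma norm_pairing_sub_sub_le (h : IsWeakEvolution ν K τ w) (hν : 0 ≤ ν) (hK : 0 ≤ K)
    {s₀ t M : ℝ} (hs₀ : 0 < s₀) (ht : t < τ)
    (hM : ∀ r ∈ Set.Icc s₀ t, l2norm (w r) ≤ M) (a : Fin 3) (ζ : 𝓢(E3, ℂ))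
    {s s' : ℝ} (hs : s ∈ Set.Icc s₀ t) (hs' : s' ∈ Set.Icc s₀ t) (hss : s ≤ s') :
    ‖pairing (fun x => w s' x a) (Δ ζ) - pairing (fun x => w s x a) (Δ ζ)
        - ((s' - s : ℝ) : ℂ) * (ν * pairing (fun x => w s x a) (Δ (Δ ζ)))‖ ≤
      (ν * (lipConst ν K M a (Δ ζ) * (s' - s)) + K * M * gradCurlCurlNorm a ζ) * (s' - s) := by
  have hmem : ∀ r ∈ Set.Icc s₀ t, r ∈ Set.Ioo 0 τ := fun r hr =>
    ⟨hs₀.trans_le hr.1, hr.2.trans_lt ht⟩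
  have hM0 : 0 ≤ M := (l2norm_nonneg _).trans (hM s hs)
  have hcp : ∀ r ∈ Set.Icc s₀ t, Continuous (pairing (fun x => w r x a)) := fun r hr =>
    continuous_pairing (memLp_coord (h.memLp r (hmem r hr)) a)
  have hcl := continuous_laplacian_schwartz
  revert ζ
  refine le_of_forall_hasCompactSupport
    ((((hcp s' hs').comp hcl).sub ((hcp s hs).comp hcl)).sub
      (continuous_const.mul (continuous_const.mul ((hcp s hs).comp (hcl.comp hcl))))).norm
    (((continuous_const.mul
      (((continuous_lipConst ν K M a).comp hcl).mul continuous_const)).add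
      (continuous_const.mul (continuous_gradCurlCurlNorm a))).mul continuous_const) fun ζ hζ => ?_
  have hsub : Set.Icc s s' ⊆ Set.Icc s₀ t := Set.Icc_subset_Icc hs.1 hs'.2
  choose! R hR hd using fun s (hs : s ∈ Set.Icc s₀ t) => h.hasDerivAt s (hmem s hs) a ζ hζ
  have hG := gradCurlCurlNorm_nonneg a ζ
  have hL := lipConst_nonneg hν hK hM0 a (Δ ζ)
  set c : ℂ := ν * pairing (fun x => w s x a) (Δ (Δ ζ)) with hc
  -- After the linear function `r ↦ r c` is subtracted, the derivative contains only the forcing and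
  -- the variation of the viscous term since time `s`. The previous lemma, applied to `Δ ζ`, bounds
  -- that variation.
  have key := Convex.norm_image_sub_le_of_norm_hasDerivWithin_le (𝕜 := ℝ) (s := Set.Icc s s')
    (f := fun r => pairing (fun x => w r x a) (Δ ζ) - (r : ℂ) * c)
    (f' := fun r => (ν * pairing (fun x => w r x a) (Δ (Δ ζ)) - R r) - 1 * c)
    (C := ν * (lipConst ν K M a (Δ ζ) * (s' - s)) + K * M * gradCurlCurlNorm a ζ)
    (x := s) (y := s')
    (fun x hx => ((hd x (hsub hx)).sub
      ((Complex.ofRealCLM.hasDerivAt (x := x)).mul_const c)).hasDerivWithinAt)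
    (fun x hx => ?_) (convex_Icc s s') (Set.left_mem_Icc.2 hss) (Set.right_mem_Icc.2 hss)
  · rw [Real.norm_of_nonneg (sub_nonneg.2 hss)] at key
    refine le_trans (le_of_eq ?_) key
    congr 1
    push_cast
    ring
  · have e : (ν * pairing (fun y => w x y a) (Δ (Δ ζ)) - R x) - 1 * c =
        ν * (pairing (fun y => w x y a) (Δ (Δ ζ)) - pairing (fun y => w s y a) (Δ (Δ ζ))) - R x := by
      rw [hc]
      ring
    rw [e]
    refine (norm_sub_le _ _).trans (add_le_add ?_ ((hR x (hsub hx)).trans ?_))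
    · rw [norm_mul, Complex.norm_real, Real.norm_of_nonneg hν]
      refine mul_le_mul_of_nonneg_left ?_ hν
      refine (h.norm_pairing_sub_le hν hK hs₀ ht hM a (Δ ζ) (hsub hx) hs).trans ?_
      rw [abs_of_nonneg (sub_nonneg.2 hx.1)]
      exact mul_le_mul_of_nonneg_left (sub_le_sub_right hx.2 _) hL
    · have := hM x (hsub hx)
      gcongr

end IsWeakEvolution
end
end RegNSE

/-! ### Fourier symbols and the backward heat flow -/

namespace RegNSE

noncomputable section

lemma fourier_lineDeriv_apply (f : 𝓢(E3, ℂ)) (m ξ : E3) :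
    𝓕 (∂_{m} f) ξ = (2 * Real.pi * Complex.I * (inner ℝ ξ m : ℝ)) * 𝓕 f ξ := by
  rw [SchwartzMap.fourier_lineDerivOp_eq, smul_apply,
    SchwartzMap.smulLeftCLM_apply_apply (by fun_prop)]
  simp only [smul_eq_mul, Complex.real_smul]
  ring

lemma norm_fourier_lineDeriv_le (f : 𝓢(E3, ℂ)) (j : Fin 3) (ξ : E3) :
    ‖𝓕 (∂_{basisVec j} f) ξ‖ ≤ (2 * Real.pi * ‖ξ‖) * ‖𝓕 f ξ‖ := by
  rw [fourier_lineDeriv_apply, norm_mul]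
  refine mul_le_mul_of_nonneg_right ?_ (norm_nonneg _)
  have h : |inner ℝ ξ (basisVec j)| ≤ ‖ξ‖ := by
    have := abs_real_inner_le_norm ξ (basisVec j)
    simpa using this
  simp only [norm_mul, Complex.norm_real, Complex.norm_I, Real.norm_eq_abs, Complex.norm_ofNat,
    abs_of_pos Real.pi_pos, mul_one]
  gcongr

lemma fourier_sum_apply {ι : Type*} (s : Finset ι) (f : ι → 𝓢(E3, ℂ)) (ξ : E3) :
    𝓕 (∑ i ∈ s, f i) ξ = ∑ i ∈ s, 𝓕 (f i) ξ := by
  have : 𝓕 (∑ i ∈ s, f i) = ∑ i ∈ s, 𝓕 (f i) :=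
    map_sum (FourierTransform.fourierCLE ℂ 𝓢(E3, ℂ)) f s
  rw [this, sum_apply]

lemma fourier_laplacian_apply (f : 𝓢(E3, ℂ)) (ξ : E3) :
    𝓕 (Δ f) ξ = -(((2 * Real.pi * ‖ξ‖) ^ 2 : ℝ) : ℂ) * 𝓕 f ξ := by
  rw [SchwartzMap.laplacian_eq_sum (EuclideanSpace.basisFun (Fin 3) ℝ), fourier_sum_apply]
  simp only [fourier_lineDeriv_apply, EuclideanSpace.basisFun_apply,
    EuclideanSpace.inner_single_right]
  have h : ‖ξ‖ ^ 2 = ∑ i : Fin 3, ξ i ^ 2 := by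
    rw [EuclideanSpace.norm_sq_eq]
    simp
  rw [mul_pow, h]
  simp only [Fin.sum_univ_three]
  push_cast
  simp only [conj_trivial, one_mul]
  linear_combination (4 * (Real.pi : ℂ) ^ 2 * ((ξ 0 : ℂ) ^ 2 + (ξ 1 : ℂ) ^ 2 + (ξ 2 : ℂ) ^ 2) * 𝓕 f ξ) * Complex.I_sq

lemma norm_fourier_laplacian (f : 𝓢(E3, ℂ)) (ξ : E3) :
    ‖𝓕 (Δ f) ξ‖ = (2 * Real.pi * ‖ξ‖) ^ 2 * ‖𝓕 f ξ‖ := by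
  rw [fourier_laplacian_apply, norm_mul, norm_neg, Complex.norm_real,
    Real.norm_of_nonneg (by positivity)]

lemma fourier_sub_apply (f g : 𝓢(E3, ℂ)) (ξ : E3) : 𝓕 (f - g) ξ = 𝓕 f ξ - 𝓕 g ξ := by
  have : 𝓕 (f - g) = 𝓕 f - 𝓕 g := map_sub (FourierTransform.fourierCLE ℂ 𝓢(E3, ℂ)) f g
  rw [this, sub_apply]

lemma fourier_add_apply (f g : 𝓢(E3, ℂ)) (ξ : E3) : 𝓕 (f + g) ξ = 𝓕 f ξ + 𝓕 g ξ := by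
  have : 𝓕 (f + g) = 𝓕 f + 𝓕 g := map_add (FourierTransform.fourierCLE ℂ 𝓢(E3, ℂ)) f g
  rw [this, add_apply]

lemma fourier_smul_apply (c : ℂ) (g : 𝓢(E3, ℂ)) (ξ : E3) : 𝓕 (c • g) ξ = c * 𝓕 g ξ := by
  have : 𝓕 (c • g) = c • 𝓕 g := map_smul (FourierTransform.fourierCLE ℂ 𝓢(E3, ℂ)) c g
  rw [this, smul_apply, smul_eq_mul]

/-- Each of the two terms of `curlCurl` has a symbol of size at most `(2π‖ξ‖)²`, whence the factor
2. -/
lemma norm_fourier_curlCurl_le (a i : Fin 3) (f : 𝓢(E3, ℂ)) (ξ : E3) :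
    ‖𝓕 (curlCurl a f i) ξ‖ ≤ 2 * (2 * Real.pi * ‖ξ‖) ^ 2 * ‖𝓕 f ξ‖ := by
  have h1 : ‖𝓕 (∂_{basisVec i} (∂_{basisVec a} f)) ξ‖ ≤ (2 * Real.pi * ‖ξ‖) ^ 2 * ‖𝓕 f ξ‖ := by
    refine (norm_fourier_lineDeriv_le _ _ _).trans ?_
    rw [pow_two, mul_assoc (2 * Real.pi * ‖ξ‖) (2 * Real.pi * ‖ξ‖)]
    exact mul_le_mul_of_nonneg_left (norm_fourier_lineDeriv_le _ _ _) (by positivity)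
  have h2 : ‖𝓕 (if i = a then Δ f else 0) ξ‖ ≤ (2 * Real.pi * ‖ξ‖) ^ 2 * ‖𝓕 f ξ‖ := by
    split_ifs
    · exact (norm_fourier_laplacian f ξ).le
    · have : 𝓕 (0 : 𝓢(E3, ℂ)) = 0 := map_zero (FourierTransform.fourierCLE ℂ 𝓢(E3, ℂ))
      rw [this, zero_apply, norm_zero]
      positivity
  rw [curlCurl, fourier_sub_apply]
  refine (norm_sub_le _ _).trans ?_
  linarith

/-- Plancherel. All heat flow estimates below reduce through it to pointwise bounds on symbols. -/
lemma norm_toLp_le_of_fourier {f g : 𝓢(E3, ℂ)} {c : ℝ}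
    (h : ∀ ξ, ‖𝓕 f ξ‖ ≤ c * ‖𝓕 g ξ‖) : ‖f.toLp 2‖ ≤ c * ‖g.toLp 2‖ := by
  rw [← SchwartzMap.norm_fourier_toL2_eq f, ← SchwartzMap.norm_fourier_toL2_eq g]
  refine Lp.norm_le_mul_norm_of_ae_le_mul ?_
  filter_upwards [(𝓕 f).coeFn_toLp 2, (𝓕 g).coeFn_toLp 2] with ξ h1 h2
  rw [h1, h2]
  exact h ξ

/-- With `θ` compactly supported on the Fourier side, multiplication by the heat factor trivially
stays in the Schwartz class. -/
lemma hasCompactSupport_heat {θ : 𝓢(E3, ℂ)} (hθ : HasCompactSupport θ) (c : ℝ) :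
    HasCompactSupport fun ξ : E3 => (Real.exp (-(c * (2 * Real.pi * ‖ξ‖) ^ 2)) : ℂ) * θ ξ :=
  hθ.mono fun ξ hξ h0 => hξ (by
    simp only [h0, mul_zero])

lemma contDiff_heat (θ : 𝓢(E3, ℂ)) (c : ℝ) :
    ContDiff ℝ ∞ fun ξ : E3 => (Real.exp (-(c * (2 * Real.pi * ‖ξ‖) ^ 2)) : ℂ) * θ ξ := by
  have : ContDiff ℝ ∞ fun ξ : E3 => Real.exp (-(c * (2 * Real.pi * ‖ξ‖) ^ 2)) := by
    simp only [mul_pow]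
    exact Real.contDiff_exp.comp
      (contDiff_const.mul (contDiff_const.mul (contDiff_norm_sq ℝ))).neg
  exact (Complex.ofRealCLM.contDiff.comp this).mul (θ.smooth ⊤)

/-- The function whose Fourier transform is `exp (-c |2 π ξ|²) θ`. -/
def heatTest {θ : 𝓢(E3, ℂ)} (hθ : HasCompactSupport θ) (c : ℝ) : 𝓢(E3, ℂ) :=
  𝓕⁻ ((hasCompactSupport_heat hθ c).toSchwartzMap (contDiff_heat θ c))

section heat

variable {θ : 𝓢(E3, ℂ)} (hθ : HasCompactSupport θ)

lemma fourier_heatTest (c : ℝ) (ξ : E3) :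
    𝓕 (heatTest hθ c) ξ = (Real.exp (-(c * (2 * Real.pi * ‖ξ‖) ^ 2)) : ℂ) * θ ξ := by
  rw [heatTest, FourierTransform.fourier_fourierInv_eq]
  rfl

lemma norm_fourier_heatTest (c : ℝ) (ξ : E3) :
    ‖𝓕 (heatTest hθ c) ξ‖ = Real.exp (-(c * (2 * Real.pi * ‖ξ‖) ^ 2)) * ‖θ ξ‖ := by
  rw [fourier_heatTest, norm_mul, Complex.norm_real, Real.norm_of_nonneg (Real.exp_nonneg _)]

lemma norm_fourier_heatTest_zero (ξ : E3) : ‖𝓕 (heatTest hθ 0) ξ‖ = ‖θ ξ‖ := by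
  rw [norm_fourier_heatTest]
  simp

lemma norm_laplacian_heatTest_le {c : ℝ} (hc : 0 ≤ c) :
    ‖(Δ (heatTest hθ c) : 𝓢(E3, ℂ)).toLp 2‖ ≤ ‖(Δ (heatTest hθ 0) : 𝓢(E3, ℂ)).toLp 2‖ := by
  refine (norm_toLp_le_of_fourier (c := 1) fun ξ => ?_).trans_eq (one_mul _)
  rw [norm_fourier_laplacian, norm_fourier_laplacian, norm_fourier_heatTest,
    norm_fourier_heatTest_zero, one_mul]
  have : Real.exp (-(c * (2 * Real.pi * ‖ξ‖) ^ 2)) ≤ 1 :=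
    Real.exp_le_one_iff.2 (neg_nonpos.2 (by positivity))
  gcongr
  exact mul_le_of_le_one_left (norm_nonneg _) this

/-- Parabolic smoothing: three derivatives of the evolved function are controlled by two derivatives
of the initial one, at the price `c^{-1/2}`. The constant is `18 = 9 · 2`: nine pairs `(i, j)`, each
with the factor 2 of the `curlCurl` symbol. -/
lemma gradCurlCurlNorm_heatTest_le (a : Fin 3) {c : ℝ} (hc : 0 < c) :
    gradCurlCurlNorm a (heatTest hθ c) ≤
      18 / √c * ‖(Δ (heatTest hθ 0) : 𝓢(E3, ℂ)).toLp 2‖ := by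
  have h : ∀ i j : Fin 3, ‖(∂_{basisVec j} (curlCurl a (heatTest hθ c) i) : 𝓢(E3, ℂ)).toLp 2‖ ≤
      2 / √c * ‖(Δ (heatTest hθ 0) : 𝓢(E3, ℂ)).toLp 2‖ := by
    intro i j
    refine norm_toLp_le_of_fourier fun ξ => ?_
    refine (norm_fourier_lineDeriv_le _ _ _).trans ?_
    have h1 := norm_fourier_curlCurl_le a i (heatTest hθ c) ξ
    rw [norm_fourier_heatTest] at h1
    rw [norm_fourier_laplacian, norm_fourier_heatTest_zero]
    set r := 2 * Real.pi * ‖ξ‖ with hr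
    have hr0 : 0 ≤ r := by positivity
    have hsc : 0 < √c := Real.sqrt_pos.2 hc
    -- With `x = r √c` this is `x ≤ 1 + x² ≤ exp (x²)`.
    have h2 : r * Real.exp (-(c * r ^ 2)) ≤ 1 / √c := by
      rw [le_div_iff₀ hsc, Real.exp_neg, mul_assoc, ← div_eq_inv_mul, ← mul_div_assoc,
        div_le_one (Real.exp_pos _)]
      have h3 := Real.add_one_le_exp (c * r ^ 2)
      have h4 : c * r ^ 2 = (r * √c) ^ 2 := by
        rw [mul_pow r, Real.sq_sqrt hc.le, mul_comm]
      nlinarith [sq_nonneg (r * √c - 1)]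
    calc r * ‖𝓕 (curlCurl a (heatTest hθ c) i) ξ‖
        ≤ r * (2 * r ^ 2 * (Real.exp (-(c * r ^ 2)) * ‖θ ξ‖)) := by gcongr
      _ = (r * Real.exp (-(c * r ^ 2))) * (2 * (r ^ 2 * ‖θ ξ‖)) := by ring
      _ ≤ 1 / √c * (2 * (r ^ 2 * ‖θ ξ‖)) := by gcongr
      _ = _ := by ring
  unfold gradCurlCurlNorm
  generalize ‖(Δ (heatTest hθ 0) : 𝓢(E3, ℂ)).toLp 2‖ = Z at h ⊢
  refine (Finset.sum_le_sum fun i _ => Finset.sum_le_sum fun j _ => h i j).trans_eq ?_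
  simp only [Finset.sum_const, Finset.card_univ, Fintype.card_fin, nsmul_eq_mul]
  push_cast
  ring

lemma abs_exp_neg_sub_exp_neg_le {x y : ℝ} (hx : 0 ≤ x) (hy : 0 ≤ y) :
    |Real.exp (-x) - Real.exp (-y)| ≤ |x - y| := by
  wlog hxy : x ≤ y generalizing x y
  · rw [abs_sub_comm, abs_sub_comm x]
    exact this hy hx (le_of_not_ge hxy)
  have h1 : Real.exp (-y) ≤ Real.exp (-x) := Real.exp_le_exp.2 (by linarith)
  rw [abs_of_nonneg (by linarith), abs_of_nonpos (by linarith)]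
  have h2 : Real.exp (-y) = Real.exp (-x) * Real.exp (-(y - x)) := by
    rw [← Real.exp_add]; congr 1; ring
  have h3 := Real.add_one_le_exp (-(y - x))
  have h4 : Real.exp (-x) ≤ 1 := Real.exp_le_one_iff.2 (by linarith)
  have h5 := Real.exp_pos (-x)
  nlinarith

lemma norm_laplacian_heatTest_sub_le {c c' : ℝ} (hc : 0 ≤ c) (hc' : 0 ≤ c') :
    ‖(Δ (heatTest hθ c - heatTest hθ c') : 𝓢(E3, ℂ)).toLp 2‖ ≤
      |c - c'| * ‖(Δ (Δ (heatTest hθ 0)) : 𝓢(E3, ℂ)).toLp 2‖ := by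
  refine norm_toLp_le_of_fourier fun ξ => ?_
  rw [norm_fourier_laplacian, norm_fourier_laplacian, norm_fourier_laplacian,
    norm_fourier_heatTest_zero, fourier_sub_apply, fourier_heatTest, fourier_heatTest, ← sub_mul,
    norm_mul, ← Complex.ofReal_sub, Complex.norm_real, Real.norm_eq_abs]
  set y := (2 * Real.pi * ‖ξ‖) ^ 2 with hy
  have hy0 : 0 ≤ y := by positivity
  have h := abs_exp_neg_sub_exp_neg_le (mul_nonneg hc hy0) (mul_nonneg hc' hy0)
  rw [← sub_mul, abs_mul, abs_of_nonneg hy0] at h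
  calc y * (|Real.exp (-(c * y)) - Real.exp (-(c' * y))| * ‖θ ξ‖)
      ≤ y * (|c - c'| * y * ‖θ ξ‖) := by gcongr
    _ = _ := by ring

/-- The left side is `e^{-z}(1 - (1 + x)e^{-x})`, and `1 - x ≤ e^{-x} ≤ 1/(1 + x)` puts the bracket
between `0` and `x²`. The expansion is centred at `z + x`, which will correspond to the earlier time
of a step. -/
lemma abs_exp_taylor_le {x z : ℝ} (hx : 0 ≤ x) (hz : 0 ≤ z) :
    |Real.exp (-z) - Real.exp (-(z + x)) - x * Real.exp (-(z + x))| ≤ x ^ 2 := by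
  have h2 : Real.exp (-(z + x)) = Real.exp (-z) * Real.exp (-x) := by
    rw [← Real.exp_add]; congr 1; ring
  have h4 : Real.exp (-z) ≤ 1 := Real.exp_le_one_iff.2 (by linarith)
  have h5 := Real.exp_pos (-z)
  have h3 := Real.add_one_le_exp (-x)
  have h6 := Real.add_one_le_exp x
  have h7 := Real.exp_pos (-x)
  have h8 : Real.exp x * Real.exp (-x) = 1 := by rw [← Real.exp_add]; simp
  have h9 : (1 + x) * Real.exp (-x) ≤ 1 := by
    rw [← h8]; gcongr; linarith
  have h10 : 1 - (1 + x) * Real.exp (-x) ≤ x ^ 2 := by nlinarith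
  have e : Real.exp (-z) - Real.exp (-(z + x)) - x * Real.exp (-(z + x)) =
      Real.exp (-z) * (1 - (1 + x) * Real.exp (-x)) := by rw [h2]; ring
  rw [e, abs_of_nonneg (mul_nonneg h5.le (by linarith))]
  nlinarith

/-- Taylor remainder of the heat flow in its time parameter. Since `Δ` has symbol `-y`, the term `h
• Δ` removes the first order part; the remaining `(h y)²` costs two more Laplacians. -/
lemma norm_laplacian_heatTest_taylor_le {c h : ℝ} (hh : 0 ≤ h) (hc : h ≤ c) :
    ‖(Δ (heatTest hθ (c - h) - heatTest hθ c + (h : ℂ) • Δ (heatTest hθ c)) :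
        𝓢(E3, ℂ)).toLp 2‖ ≤
      h ^ 2 * ‖(Δ (Δ (Δ (heatTest hθ 0))) : 𝓢(E3, ℂ)).toLp 2‖ := by
  refine norm_toLp_le_of_fourier fun ξ => ?_
  rw [norm_fourier_laplacian, norm_fourier_laplacian, norm_fourier_laplacian,
    norm_fourier_laplacian,
    norm_fourier_heatTest_zero, fourier_add_apply, fourier_sub_apply, fourier_smul_apply,
    fourier_laplacian_apply, fourier_heatTest, fourier_heatTest]
  set y := (2 * Real.pi * ‖ξ‖) ^ 2 with hy
  have hy0 : 0 ≤ y := by positivity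
  have key := abs_exp_taylor_le (mul_nonneg hh hy0) (mul_nonneg (sub_nonneg.2 hc) hy0)
  rw [← add_mul, sub_add_cancel] at key
  have e : (Real.exp (-((c - h) * y)) : ℂ) * θ ξ - (Real.exp (-(c * y)) : ℂ) * θ ξ
      + (h : ℂ) * (-(y : ℂ) * ((Real.exp (-(c * y)) : ℂ) * θ ξ)) =
      ((Real.exp (-((c - h) * y)) - Real.exp (-(c * y)) - h * y * Real.exp (-(c * y)) : ℝ) : ℂ)
        * θ ξ := by
    push_cast; ring
  rw [e, norm_mul, Complex.norm_real, Real.norm_eq_abs]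
  calc _ ≤ y * ((h * y) ^ 2 * ‖θ ξ‖) := by gcongr
    _ = _ := by ring

end heat

end
end RegNSE

/-! ### Duhamel estimate by duality with the backward heat flow -/

namespace RegNSE

noncomputable section

lemma laplacian_add_schwartz (f g : 𝓢(E3, ℂ)) : Δ (f + g) = Δ f + Δ g :=
  map_add (LineDeriv.laplacianCLM ℝ E3 𝓢(E3, ℂ)) f g

lemma laplacian_sub_schwartz (f g : 𝓢(E3, ℂ)) : Δ (f - g) = Δ f - Δ g :=
  map_sub (LineDeriv.laplacianCLM ℝ E3 𝓢(E3, ℂ)) f g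

lemma laplacian_smul_schwartz (c : ℂ) (f : 𝓢(E3, ℂ)) : Δ (c • f) = c • Δ f := by
  rw [← SchwartzMap.laplacianCLM_eq ℂ, ← SchwartzMap.laplacianCLM_eq ℂ, map_smul]

namespace IsWeakEvolution

variable {ν K τ : ℝ} {w : ℝ → E3 → E3}

/-- Along the backward heat flow the pairing of a weak evolution grows only through the forcing
term, up to a quadratic error in the time step. -/
lemma norm_pairing_heatTest_sub_le (h : IsWeakEvolution ν K τ w) (hν : 0 ≤ ν) (hK : 0 ≤ K)
    {s₀ t M : ℝ} (hs₀ : 0 < s₀) (ht : t < τ)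
    (hM : ∀ r ∈ Set.Icc s₀ t, l2norm (w r) ≤ M) (a : Fin 3) {θ : 𝓢(E3, ℂ)}
    (hθ : HasCompactSupport θ) {s s' : ℝ} (hs : s ∈ Set.Icc s₀ t) (hs' : s' ∈ Set.Icc s₀ t)
    (hss : s ≤ s') :
    ‖pairing (fun x => w s' x a) (Δ (heatTest hθ (ν * (t - s')))) -
        pairing (fun x => w s x a) (Δ (heatTest hθ (ν * (t - s))))‖ ≤
      (K * M * gradCurlCurlNorm a (heatTest hθ (ν * (t - s))) +
        (2 * ν * lipConst ν K M a (Δ (heatTest hθ (ν * (t - s)))) +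
          M * ν ^ 2 * ‖(Δ (Δ (Δ (heatTest hθ 0))) : 𝓢(E3, ℂ)).toLp 2‖) * (s' - s)) * (s' - s) := by
  have hmem : ∀ r ∈ Set.Icc s₀ t, r ∈ Set.Ioo 0 τ := fun r hr =>
    ⟨hs₀.trans_le hr.1, hr.2.trans_lt ht⟩
  have hM0 : 0 ≤ M := (l2norm_nonneg _).trans (hM s hs)
  have hf' := memLp_coord (h.memLp s' (hmem s' hs')) a
  set δ := s' - s with hδ
  have hδ0 : 0 ≤ δ := sub_nonneg.2 hss
  set ζ := heatTest hθ (ν * (t - s)) with hζ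
  have hζ' : heatTest hθ (ν * (t - s')) = heatTest hθ (ν * (t - s) - ν * δ) := by
    congr 1; rw [hδ]; ring
  have h1 := h.norm_pairing_sub_sub_le hν hK hs₀ ht hM a ζ hs hs' hss
  have h2 := h.norm_pairing_sub_le hν hK hs₀ ht hM a (Δ ζ) hs' hs
  rw [← hδ] at h1
  rw [← hδ, abs_of_nonneg hδ0] at h2
  have h3 : ‖pairing (fun x => w s' x a)
      (Δ (heatTest hθ (ν * (t - s')) - ζ + ((ν * δ : ℝ) : ℂ) • Δ ζ))‖ ≤
      M * ((ν * δ) ^ 2 * ‖(Δ (Δ (Δ (heatTest hθ 0))) : 𝓢(E3, ℂ)).toLp 2‖) := by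
    refine (h.norm_pairing_le_of_le (hmem s' hs') (hM s' hs') a _).trans ?_
    refine mul_le_mul_of_nonneg_left ?_ hM0
    rw [hζ']
    exact norm_laplacian_heatTest_taylor_le hθ (mul_nonneg hν hδ0)
      (mul_le_mul_of_nonneg_left (by linarith [hs'.2]) hν)
  rw [laplacian_add_schwartz, laplacian_sub_schwartz, laplacian_smul_schwartz,
    pairing_add hf', pairing_sub hf', pairing_smul] at h3
  generalize pairing (fun x => w s' x a) (Δ (heatTest hθ (ν * (t - s')))) = p1 at h3 ⊢
  generalize pairing (fun x => w s' x a) (Δ ζ) = p2 at *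
  generalize pairing (fun x => w s' x a) (Δ (Δ ζ)) = p3 at *
  generalize pairing (fun x => w s x a) (Δ ζ) = p4 at *
  generalize pairing (fun x => w s x a) (Δ (Δ ζ)) = p5 at *
  -- The three groups are the Taylor remainder of the test function, the variation in time of the
  -- viscous pairing, and the increment of `w` corrected by its viscous part. The viscous
  -- contributions of the heat flow and of the equation cancel, which leaves the forcing and terms
  -- of order `δ²`.
  have e : p1 - p4 = (p1 - p2 + ((ν * δ : ℝ) : ℂ) * p3) - ((ν * δ : ℝ) : ℂ) * (p3 - p5)
      + (p2 - p4 - (δ : ℂ) * (ν * p5)) := by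
    push_cast; ring
  rw [e]
  have h4 : ‖((ν * δ : ℝ) : ℂ) * (p3 - p5)‖ ≤ ν * δ * (lipConst ν K M a (Δ ζ) * δ) := by
    rw [norm_mul, Complex.norm_real, Real.norm_of_nonneg (mul_nonneg hν hδ0)]
    exact mul_le_mul_of_nonneg_left h2 (mul_nonneg hν hδ0)
  refine (norm_add_le _ _).trans ((add_le_add ((norm_sub_le _ _).trans (add_le_add h3 h4))
    h1).trans_eq ?_)
  ring

lemma continuousOn_norm_pairing_heatTest (h : IsWeakEvolution ν K τ w) (hν : 0 ≤ ν) (hK : 0 ≤ K)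
    {s₀ t M : ℝ} (hs₀ : 0 < s₀) (ht : t < τ)
    (hM : ∀ r ∈ Set.Icc s₀ t, l2norm (w r) ≤ M) (a : Fin 3) {θ : 𝓢(E3, ℂ)}
    (hθ : HasCompactSupport θ) :
    ContinuousOn (fun s => ‖pairing (fun x => w s x a) (Δ (heatTest hθ (ν * (t - s))))‖)
      (Set.Icc s₀ t) := by
  have hmem : ∀ r ∈ Set.Icc s₀ t, r ∈ Set.Ioo 0 τ := fun r hr =>
    ⟨hs₀.trans_le hr.1, hr.2.trans_lt ht⟩
  refine ContinuousOn.norm fun r hr => ?_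
  have hM0 : 0 ≤ M := (l2norm_nonneg _).trans (hM r hr)
  rw [ContinuousWithinAt, tendsto_iff_norm_sub_tendsto_zero]
  set ζ := heatTest hθ (ν * (t - r)) with hζ
  set L := M * (ν * ‖(Δ (Δ (heatTest hθ 0)) : 𝓢(E3, ℂ)).toLp 2‖) + lipConst ν K M a ζ with hL
  have hlim : Tendsto (fun s => L * |s - r|) (𝓝[Set.Icc s₀ t] r) (𝓝 0) := by
    have : Continuous fun s : ℝ => L * |s - r| := by fun_prop
    have h0 := this.tendsto r
    simp only [sub_self, abs_zero, mul_zero] at h0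
    exact h0.mono_left nhdsWithin_le_nhds
  refine squeeze_zero' (Eventually.of_forall fun _ => norm_nonneg _) ?_ hlim
  filter_upwards [self_mem_nhdsWithin] with s hs
  have h1 : ‖pairing (fun x => w s x a) (Δ (heatTest hθ (ν * (t - s)) - ζ))‖ ≤
      M * (|ν * (t - s) - ν * (t - r)| * ‖(Δ (Δ (heatTest hθ 0)) : 𝓢(E3, ℂ)).toLp 2‖) := by
    refine (h.norm_pairing_le_of_le (hmem s hs) (hM s hs) a _).trans ?_
    refine mul_le_mul_of_nonneg_left ?_ hM0
    exact norm_laplacian_heatTest_sub_le hθ (mul_nonneg hν (sub_nonneg.2 hs.2))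
      (mul_nonneg hν (sub_nonneg.2 hr.2))
  have h2 := h.norm_pairing_sub_le hν hK hs₀ ht hM a ζ hs hr
  have e : |ν * (t - s) - ν * (t - r)| = ν * |s - r| := by
    rw [← mul_sub, abs_mul, abs_of_nonneg hν, abs_sub_comm s r]
    congr 2
    ring
  rw [e] at h1
  rw [laplacian_sub_schwartz, pairing_sub (memLp_coord (h.memLp s (hmem s hs)) a)] at h1
  refine (norm_sub_le_norm_sub_add_norm_sub _ _ _).trans ((add_le_add h1 h2).trans_eq ?_)
  rw [hL]
  ring

/-- A Duhamel estimate for weak evolutions. -/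
lemma norm_pairing_le_duhamel (h : IsWeakEvolution ν K τ w) (hν : 0 < ν) (hK : 0 ≤ K)
    {s₀ t M : ℝ} (hs₀ : 0 < s₀) (hst : s₀ ≤ t) (ht : t < τ)
    (hM : ∀ r ∈ Set.Icc s₀ t, l2norm (w r) ≤ M) (a : Fin 3) {θ : 𝓢(E3, ℂ)}
    (hθ : HasCompactSupport θ) :
    ‖pairing (fun x => w t x a) (Δ (heatTest hθ 0))‖ ≤
      (l2norm (w s₀) + 36 * K * M / ν * √(ν * (t - s₀))) *
        ‖(Δ (heatTest hθ 0) : 𝓢(E3, ℂ)).toLp 2‖ := by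
  have hM0 : 0 ≤ M := (l2norm_nonneg _).trans (hM t (Set.right_mem_Icc.2 hst))
  set Z := ‖(Δ (heatTest hθ 0) : 𝓢(E3, ℂ)).toLp 2‖ with hZ
  have hZ0 : 0 ≤ Z := norm_nonneg _
  set f : ℝ → ℝ := fun s => ‖pairing (fun x => w s x a) (Δ (heatTest hθ (ν * (t - s))))‖ with hf
  -- Only upper bounds on right difference quotients of `f` are known, so a comparison principle
  -- replaces integration. The function `B` is the primitive of the forcing bound `18 K M Z /
  -- √(ν(t-s))` starting from `‖w(s₀)‖₂ Z`; its derivative is needed only for `s < t`, away from the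
  -- singularity.
  have key := image_le_of_liminf_slope_right_le_deriv_boundary (f := f) (a := s₀) (b := t)
    (B := fun s => l2norm (w s₀) * Z +
      36 * K * M * Z / ν * (√(ν * (t - s₀)) - √(ν * (t - s))))
    (B' := fun s => K * M * (18 / √(ν * (t - s)) * Z))
    (h.continuousOn_norm_pairing_heatTest hν.le hK hs₀ ht hM a hθ) ?_ ?_ ?_ ?_
    (Set.right_mem_Icc.2 hst)
  · simp only [hf, sub_self, mul_zero, Real.sqrt_zero, sub_zero] at key
    refine key.trans_eq ?_
    ring
  · simp only [hf, sub_self, mul_zero, add_zero]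
    refine (h.norm_pairing_le_of_le ⟨hs₀, hst.trans_lt ht⟩ le_rfl a _).trans ?_
    exact mul_le_mul_of_nonneg_left
      (norm_laplacian_heatTest_le hθ (mul_nonneg hν.le (sub_nonneg.2 hst))) (l2norm_nonneg _)
  · exact Continuous.continuousOn (by fun_prop)
  · intro s hs
    have hp : 0 < ν * (t - s) := mul_pos hν (sub_pos.2 hs.2)
    have h1 : HasDerivAt (fun s => ν * (t - s)) (ν * (-1)) s :=
      ((hasDerivAt_id s).const_sub t).const_mul ν
    have h2 := (((h1.sqrt hp.ne').const_sub √(ν * (t - s₀))).const_mul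
      (36 * K * M * Z / ν)).const_add (l2norm (w s₀) * Z)
    refine (h2.congr_deriv ?_).hasDerivWithinAt
    have : √(ν * (t - s)) ≠ 0 := (Real.sqrt_pos.2 hp).ne'
    field_simp
    ring
  · intro s hs r hr
    have hs' : s ∈ Set.Icc s₀ t := ⟨hs.1, hs.2.le⟩
    have hp : 0 < ν * (t - s) := mul_pos hν (sub_pos.2 hs.2)
    refine Eventually.frequently ?_
    set G := gradCurlCurlNorm a (heatTest hθ (ν * (t - s))) with hG
    set Q := 2 * ν * lipConst ν K M a (Δ (heatTest hθ (ν * (t - s)))) +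
          M * ν ^ 2 * ‖(Δ (Δ (Δ (heatTest hθ 0))) : 𝓢(E3, ℂ)).toLp 2‖ with hQ
    have hGr : K * M * G < r := lt_of_le_of_lt (mul_le_mul_of_nonneg_left
      (gradCurlCurlNorm_heatTest_le hθ a hp) (mul_nonneg hK hM0)) hr
    -- The quadratic error adds `Q (z - s)` to the slope, with `Q` independent of `z`, and
    -- disappears in the limit.
    have hlim : Tendsto (fun z => K * M * G + Q * (z - s)) (𝓝[>] s) (𝓝 (K * M * G)) := by
      have : Continuous fun z : ℝ => K * M * G + Q * (z - s) := by fun_prop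
      have h0 := this.tendsto s
      simp only [sub_self, mul_zero, add_zero] at h0
      exact h0.mono_left nhdsWithin_le_nhds
    filter_upwards [hlim.eventually_lt_const hGr, Ioo_mem_nhdsGT hs.2] with z hz hz'
    refine lt_of_le_of_lt ?_ hz
    rw [slope_def_field, div_le_iff₀ (sub_pos.2 hz'.1)]
    have h1 := h.norm_pairing_heatTest_sub_le hν.le hK hs₀ ht hM a hθ hs'
      (⟨hs.1.trans hz'.1.le, hz'.2.le⟩ : z ∈ Set.Icc s₀ t) hz'.1.le
    exact (norm_sub_norm_le _ _).trans h1

end IsWeakEvolution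

end
end RegNSE

/-! ### From tested bounds to `L²` bounds, and vanishing of weak evolutions -/

namespace RegNSE

noncomputable section

/-- The compactly supported functions, as a subspace of the Schwartz space. -/
def compactSupportSchwartz : Submodule ℂ 𝓢(E3, ℂ) where
  carrier := {θ | HasCompactSupport θ}
  add_mem' hf hg := HasCompactSupport.add hf hg
  zero_mem' := HasCompactSupport.zero
  smul_mem' c _ hf := HasCompactSupport.smul_left (f := fun _ => c) hf

/-- The map `θ ↦ Δ 𝓕⁻ θ`, with values in `L²`. -/
def laplacianFourierInv : 𝓢(E3, ℂ) →ₗ[ℂ] Lp ℂ 2 (volume : Measure E3) :=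
  ((SchwartzMap.toLpCLM ℂ ℂ 2 (volume : Measure E3)).comp
    (LineDeriv.laplacianCLM ℂ E3 𝓢(E3, ℂ))).toLinearMap.comp
    (FourierTransform.fourierCLE ℂ 𝓢(E3, ℂ)).symm.toLinearEquiv.toLinearMap

lemma laplacianFourierInv_apply (θ : 𝓢(E3, ℂ)) :
    laplacianFourierInv θ = (Δ (𝓕⁻ θ) : 𝓢(E3, ℂ)).toLp 2 := by
  rw [← SchwartzMap.laplacianCLM_eq ℂ]
  rfl

lemma fourier_laplacian_fourierInv (θ : 𝓢(E3, ℂ)) (ξ : E3) :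
    𝓕 (Δ (𝓕⁻ θ)) ξ = -(((2 * Real.pi * ‖ξ‖) ^ 2 : ℝ) : ℂ) * θ ξ := by
  rw [fourier_laplacian_apply, FourierTransform.fourier_fourierInv_eq]

/-- If `h` is orthogonal to the range, then `|2πξ|² ĥ` integrates to zero against every test
function and so vanishes almost everywhere. The symbol is zero only at the origin, a null set, hence
`ĥ = 0`. -/
lemma dense_laplacianFourierInv :
    (compactSupportSchwartz.map laplacianFourierInv).topologicalClosure = ⊤ := by
  rw [Submodule.topologicalClosure_eq_top_iff, Submodule.eq_bot_iff]
  intro h hh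
  set H : Lp ℂ 2 (volume : Measure E3) := 𝓕 h with hH
  have hloc : LocallyIntegrable (fun ξ : E3 => (((2 * Real.pi * ‖ξ‖) ^ 2 : ℝ)) • H ξ) := by
    have h1 : LocallyIntegrable H := (Lp.memLp H).locallyIntegrable (by norm_num)
    have h2 : Continuous fun ξ : E3 => (2 * Real.pi * ‖ξ‖) ^ 2 := by fun_prop
    exact h1.continuous_smul h2
  have hz := ae_eq_zero_of_integral_contDiff_smul_eq_zero hloc (fun g hg hgc => ?_)
  · have hne : ∀ᵐ ξ : E3, ξ ≠ 0 := by
      simp [ae_iff]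
    have hH0 : H = 0 := by
      rw [Lp.eq_zero_iff_ae_eq_zero]
      filter_upwards [hz, hne] with ξ h1 h2
      rcases smul_eq_zero.1 h1 with h3 | h3
      · have : 0 < 2 * Real.pi * ‖ξ‖ := by have := norm_pos_iff.2 h2; positivity
        exact absurd h3 (by positivity)
      · exact h3
    rw [← norm_eq_zero, ← Lp.norm_fourier_eq, ← hH, hH0, norm_zero]
  · have hgc' : HasCompactSupport fun x : E3 => (g x : ℂ) :=
      hgc.comp_left (g := fun r : ℝ => (r : ℂ)) Complex.ofReal_zero
    set θ : 𝓢(E3, ℂ) := hgc'.toSchwartzMap (Complex.ofRealCLM.contDiff.comp hg) with hθ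
    have h1 : inner ℂ (laplacianFourierInv θ) h = 0 :=
      hh _ (Submodule.mem_map_of_mem (show θ ∈ compactSupportSchwartz from hgc'))
    rw [laplacianFourierInv_apply, ← Lp.inner_fourier_eq, SchwartzMap.toLp_fourier_eq,
      L2.inner_def] at h1
    rw [← neg_eq_zero, ← integral_neg, ← h1]
    refine integral_congr_ae ?_
    filter_upwards [(𝓕 (Δ (𝓕⁻ θ))).coeFn_toLp 2] with ξ hξ
    rw [hξ, fourier_laplacian_fourierInv]
    have : θ ξ = (g ξ : ℂ) := rfl
    rw [this, RCLike.inner_apply, ← Complex.ofReal_neg, ← Complex.ofReal_mul]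
    simp only [Complex.real_smul, Complex.conj_ofReal, hH]
    push_cast
    ring

lemma fourierInv_eq_heatTest_zero {θ : 𝓢(E3, ℂ)} (hθ : HasCompactSupport θ) :
    𝓕⁻ θ = heatTest hθ 0 := by
  rw [heatTest]
  congr 1
  ext ξ
  change θ ξ = (Real.exp (-(0 * (2 * Real.pi * ‖ξ‖) ^ 2)) : ℂ) * θ ξ
  simp

/-- The `L²` norm is determined by testing against Laplacians of band limited functions. -/
lemma l2norm_le_of_forall_heatTest {f : E3 → ℝ} (hf : MemLp f 2) {C : ℝ} (hC : 0 ≤ C)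
    (h : ∀ (θ : 𝓢(E3, ℂ)) (hθ : HasCompactSupport θ), ‖pairing f (Δ (heatTest hθ 0))‖ ≤
      C * ‖(Δ (heatTest hθ 0) : 𝓢(E3, ℂ)).toLp 2‖) : l2norm f ≤ C := by
  have hfc : MemLp (fun x => (f x : ℂ)) 2 (volume : Measure E3) := hf.ofReal
  set F := hfc.toLp with hF
  have hFn : ‖F‖ = l2norm f := by
    rw [hF, Lp.norm_toLp, l2norm]
    congr 1
    refine eLpNorm_congr_norm_ae (Eventually.of_forall fun x => ?_)
    exact Complex.norm_real _
  have hcl : IsClosed {ψ : Lp ℂ 2 (volume : Measure E3) | ‖inner ℂ F ψ‖ ≤ C * ‖ψ‖} :=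
    isClosed_le (by fun_prop) (by fun_prop)
  have hsub : ((compactSupportSchwartz.map laplacianFourierInv : Submodule ℂ _) :
      Set (Lp ℂ 2 (volume : Measure E3))) ⊆ {ψ | ‖inner ℂ F ψ‖ ≤ C * ‖ψ‖} := by
    rintro _ ⟨θ, hθ, rfl⟩
    have hθ' : HasCompactSupport θ := hθ
    have h1 := h θ hθ'
    rw [Set.mem_ofPred_eq, laplacianFourierInv_apply, fourierInv_eq_heatTest_zero hθ']
    refine le_trans (le_of_eq ?_) h1
    congr 1
    rw [L2.inner_def, pairing]
    refine integral_congr_ae ?_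
    filter_upwards [(Δ (heatTest hθ' 0) : 𝓢(E3, ℂ)).coeFn_toLp 2, hfc.coeFn_toLp] with x hx hx'
    rw [hx, hF, hx', RCLike.inner_apply, Complex.real_smul, Complex.conj_ofReal, mul_comm]
  have hmem : F ∈ (compactSupportSchwartz.map laplacianFourierInv).topologicalClosure := by
    rw [dense_laplacianFourierInv]
    trivial
  -- By density `F` itself may serve as the test function, which gives `‖F‖² ≤ C ‖F‖`.
  have h2 : ‖inner ℂ F F‖ ≤ C * ‖F‖ := hcl.closure_subset_iff.2 hsub hmem
  rw [inner_self_eq_norm_sq_to_K, norm_pow, RCLike.norm_ofReal, abs_of_nonneg (norm_nonneg _),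
    hFn] at h2
  by_contra hlt
  push Not at hlt
  nlinarith [l2norm_nonneg f]

lemma l2norm_le_sum_coord {v : E3 → E3} (hv : MemLp v 2) :
    l2norm v ≤ ∑ a : Fin 3, l2norm (fun x => v x a) := by
  have h1 : eLpNorm v 2 (volume : Measure E3) ≤
      ∑ a : Fin 3, eLpNorm (fun x => v x a) 2 (volume : Measure E3) := by
    have h2 : v = ∑ a : Fin 3, fun x => v x a • basisVec a := by
      ext x i
      simp [Finset.sum_apply, Fin.sum_univ_three]
      fin_cases i <;> simp
    calc eLpNorm v 2 (volume : Measure E3)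
        = eLpNorm (∑ a : Fin 3, fun x => v x a • basisVec a) 2 (volume : Measure E3) := by
          rw [← h2]
      _ ≤ ∑ a : Fin 3, eLpNorm (fun x => v x a • basisVec a) 2 (volume : Measure E3) :=
          eLpNorm_sum_le (fun a _ => (memLp_coord hv a).1.smul_const _) (by norm_num)
      _ ≤ _ := by
          refine Finset.sum_le_sum fun a _ => eLpNorm_mono fun x => ?_
          rw [norm_smul]
          simp
  have hfin : ∀ a ∈ Finset.univ, eLpNorm (fun x => v x a) 2 (volume : Measure E3) ≠ ⊤ :=
    fun a _ => (memLp_coord hv a).2.ne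
  unfold l2norm
  rw [← ENNReal.toReal_sum hfin]
  exact ENNReal.toReal_mono (ENNReal.sum_ne_top.2 hfin) h1

namespace IsWeakEvolution

variable {ν K τ : ℝ} {w : ℝ → E3 → E3}

/-- The factor 3 counts the components of `w`. -/
lemma l2norm_le_duhamel (h : IsWeakEvolution ν K τ w) (hν : 0 < ν) (hK : 0 ≤ K)
    {s₀ t M : ℝ} (hs₀ : 0 < s₀) (hst : s₀ ≤ t) (ht : t < τ)
    (hM : ∀ r ∈ Set.Icc s₀ t, l2norm (w r) ≤ M) :
    l2norm (w t) ≤ 3 * (l2norm (w s₀) + 36 * K * M / ν * √(ν * (t - s₀))) := by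
  have hmem := h.memLp t ⟨hs₀.trans_le hst, ht⟩
  have hM0 : 0 ≤ M := (l2norm_nonneg _).trans (hM t (Set.right_mem_Icc.2 hst))
  have hC : 0 ≤ l2norm (w s₀) + 36 * K * M / ν * √(ν * (t - s₀)) :=
    add_nonneg (l2norm_nonneg _) (by positivity)
  refine (l2norm_le_sum_coord hmem).trans ?_
  refine (Finset.sum_le_card_nsmul _ _ _ fun a _ =>
    l2norm_le_of_forall_heatTest (memLp_coord hmem a) hC fun θ hθ =>
      h.norm_pairing_le_duhamel hν hK hs₀ hst ht hM a hθ).trans_eq ?_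
  rw [Finset.card_univ, Fintype.card_fin, nsmul_eq_mul]
  norm_num

/-- If a weak evolution becomes small arbitrarily close after time `t₀`, it vanishes for a short
time after `t₀`, whose length does not depend on `t₀`. -/
lemma l2norm_eq_zero_step (h : IsWeakEvolution ν K τ w) (hν : 0 < ν) (hK : 0 ≤ K)
    {C : ℝ} (hC : ∀ s ∈ Set.Ioo 0 τ, l2norm (w s) ≤ C) {δ : ℝ}
    (hδ : 216 * K / ν * √(ν * δ) ≤ 1) {t₀ : ℝ}
    (h₀ : ∀ η > 0, ∃ s₀ ∈ Set.Ico t₀ (t₀ + η), 0 < s₀ ∧ l2norm (w s₀) ≤ η)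
    {t : ℝ} (ht₀ : t₀ < t) (htδ : t ≤ t₀ + δ) (ht : t < τ) : l2norm (w t) = 0 := by
  -- The Duhamel bound improves itself. Since `216 = 6 · 36`, the choice of `δ` makes the forcing
  -- term at most `M / 6`, hence at most `M / 2` after the factor 3.
  have main : ∀ n : ℕ, ∀ t, t₀ < t → t ≤ t₀ + δ → t < τ → l2norm (w t) ≤ C * (1 / 2) ^ n := by
    intro n
    induction n with
    | zero =>
      intro t h1 _ h3
      obtain ⟨s₀, hs, hs0, _⟩ := h₀ (t - t₀) (sub_pos.2 h1)
      have : s₀ < t := by linarith [hs.2]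
      simpa using hC t ⟨hs0.trans this, h3⟩
    | succ n ih =>
      intro t h1 h2 h3
      have hC0 : 0 ≤ C * (1 / 2) ^ n := (l2norm_nonneg _).trans (ih t h1 h2 h3)
      refine le_of_forall_pos_le_add fun η hη => ?_
      obtain ⟨s₀, hs, hs0, hsη⟩ := h₀ (min (t - t₀) (η / 6))
        (lt_min (sub_pos.2 h1) (by linarith))
      have hst : s₀ < t := by linarith [hs.2, min_le_left (t - t₀) (η / 6)]
      have hsη' := hsη.trans (min_le_right _ _)
      -- The induction hypothesis covers only times after `t₀`. If `s₀ = t₀`, the value there is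
      -- covered by `η / 6`. The total error is `3(η/6 + η/36) ≤ η`.
      have hM : ∀ r ∈ Set.Icc s₀ t, l2norm (w r) ≤ C * (1 / 2) ^ n + η / 6 := by
        intro r hr
        rcases eq_or_lt_of_le (hs.1.trans hr.1) with h4 | h4
        · have : r = s₀ := le_antisymm (h4 ▸ hs.1) hr.1
          rw [this]
          linarith
        · linarith [ih r h4 (hr.2.trans h2) (hr.2.trans_lt h3)]
      have h5 := h.l2norm_le_duhamel hν hK hs0 hst.le h3 hM
      have h6 : √(ν * (t - s₀)) ≤ √(ν * δ) :=
        Real.sqrt_le_sqrt (mul_le_mul_of_nonneg_left (by linarith [hs.1]) hν.le)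
      have h7 : 36 * K * (C * (1 / 2) ^ n + η / 6) / ν * √(ν * (t - s₀)) ≤
          (C * (1 / 2) ^ n + η / 6) / 6 := by
        calc _ = (C * (1 / 2) ^ n + η / 6) / 6 * (216 * K / ν * √(ν * (t - s₀))) := by ring
          _ ≤ (C * (1 / 2) ^ n + η / 6) / 6 * (216 * K / ν * √(ν * δ)) := by gcongr
          _ ≤ (C * (1 / 2) ^ n + η / 6) / 6 * 1 := by gcongr
          _ = _ := mul_one _
      rw [pow_succ]
      linarith
  have hlim : Tendsto (fun n : ℕ => C * (1 / 2 : ℝ) ^ n) atTop (𝓝 0) := by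
    simpa using (tendsto_pow_atTop_nhds_zero_of_lt_one (by norm_num : (0 : ℝ) ≤ 1 / 2)
      (by norm_num)).const_mul C
  exact le_antisymm (ge_of_tendsto' hlim fun n => main n t ht₀ htδ ht) (l2norm_nonneg _)

/-- A bounded weak evolution with vanishing initial value vanishes. -/
theorem l2norm_eq_zero (h : IsWeakEvolution ν K τ w) (hν : 0 < ν) (hK : 0 ≤ K)
    {C : ℝ} (hC : ∀ s ∈ Set.Ioo 0 τ, l2norm (w s) ≤ C)
    (h₀ : Tendsto (fun s => l2norm (w s)) (𝓝[>] 0) (𝓝 0)) :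
    ∀ t ∈ Set.Ioo 0 τ, l2norm (w t) = 0 := by
  obtain ⟨δ, hδ0, hδ⟩ : ∃ δ > 0, 216 * K / ν * √(ν * δ) ≤ 1 := by
    have hc : Continuous fun δ : ℝ => 216 * K / ν * √(ν * δ) := by fun_prop
    have h1 := hc.tendsto 0
    simp only [mul_zero, Real.sqrt_zero] at h1
    have h2 : ∀ᶠ δ in 𝓝[>] (0 : ℝ), 216 * K / ν * √(ν * δ) < 1 :=
      (h1.mono_left nhdsWithin_le_nhds).eventually_lt_const one_pos
    obtain ⟨δ, h3, h4⟩ := (h2.and self_mem_nhdsWithin).exists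
    exact ⟨δ, h4, h3.le⟩
  have main : ∀ n : ℕ, ∀ t, 0 < t → t ≤ n * δ → t < τ → l2norm (w t) = 0 := by
    intro n
    induction n with
    | zero =>
      intro t h1 h2
      simp only [Nat.cast_zero, zero_mul] at h2
      linarith
    | succ n ih =>
      intro t h1 h2 h3
      by_cases h4 : t ≤ n * δ
      · exact ih t h1 h4 h3
      push Not at h4
      refine h.l2norm_eq_zero_step hν hK hC hδ (t₀ := n * δ) ?_ h4
        (h2.trans_eq (by push_cast; ring)) h3
      intro η hη
      -- The first interval starts from the limit at `0⁺`, because the evolution is not controlled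
      -- at time `0`. Later ones start at `n δ`, where `w` already vanishes.
      rcases Nat.eq_zero_or_pos n with rfl | hn
      · have h5 := (h₀.eventually_lt_const hη).and (Ioo_mem_nhdsGT hη)
        obtain ⟨s, h6, h7⟩ := h5.exists
        exact ⟨s, by simpa using ⟨h7.1.le, h7.2⟩, h7.1, h6.le⟩
      · have hp : 0 < (n : ℝ) * δ := mul_pos (by exact_mod_cast hn) hδ0
        refine ⟨n * δ, ⟨le_rfl, by linarith⟩, hp, ?_⟩
        rw [ih (n * δ) hp le_rfl (h4.trans h3)]
        exact hη.le
  intro t ht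
  obtain ⟨n, hn⟩ := exists_nat_ge (t / δ)
  exact main n t ht.1 ((div_le_iff₀ hδ0).1 hn) ht.2

end IsWeakEvolution

end
end RegNSE

/-! ### Integration by parts against the solenoidal test fields -/

namespace RegNSE

noncomputable section

lemma schwartz_ext_fourier {f g : 𝓢(E3, ℂ)} (h : ∀ ξ, 𝓕 f ξ = 𝓕 g ξ) : f = g :=
  (FourierTransform.fourierCLE ℂ 𝓢(E3, ℂ)).injective (SchwartzMap.ext h)

lemma curlCurl_laplacian (a i : Fin 3) (ζ : 𝓢(E3, ℂ)) :
    curlCurl a (Δ ζ) i = Δ (curlCurl a ζ i) := by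
  have h : Δ (if i = a then Δ ζ else 0) = (if i = a then Δ (Δ ζ) else (0 : 𝓢(E3, ℂ))) := by
    split_ifs
    · rfl
    · exact map_zero (LineDeriv.laplacianCLM ℝ E3 𝓢(E3, ℂ))
  rw [curlCurl, curlCurl, laplacian_sub_schwartz, h]
  congr 1
  refine schwartz_ext_fourier fun ξ => ?_
  simp only [fourier_lineDeriv_apply, fourier_laplacian_apply]
  ring

/-- The divergence of a curl vanishes: here `Δ ∂_a - ∂_a Δ = 0`, checked on symbols. -/
lemma sum_lineDeriv_curlCurl (a : Fin 3) (ζ : 𝓢(E3, ℂ)) :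
    ∑ i : Fin 3, (∂_{basisVec i} (curlCurl a ζ i) : 𝓢(E3, ℂ)) = 0 := by
  have h : ∀ i : Fin 3, (∂_{basisVec i} (curlCurl a ζ i) : 𝓢(E3, ℂ)) =
      ∂_{basisVec i} (∂_{basisVec i} (∂_{basisVec a} ζ)) -
        if i = a then ∂_{basisVec a} (Δ ζ) else 0 := by
    intro i
    have e : (∂_{basisVec i} (curlCurl a ζ i) : 𝓢(E3, ℂ)) =
        ∂_{basisVec i} (∂_{basisVec i} (∂_{basisVec a} ζ)) -
          ∂_{basisVec i} (if i = a then Δ ζ else 0) := by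
      rw [curlCurl]
      exact map_sub (LineDeriv.lineDerivOpCLM ℝ 𝓢(E3, ℂ) (basisVec i)) _ _
    rw [e]
    congr 1
    split_ifs with hi
    · rw [hi]
    · exact map_zero (LineDeriv.lineDerivOpCLM ℝ 𝓢(E3, ℂ) (basisVec i))
  simp only [h, Finset.sum_sub_distrib, Finset.sum_ite_eq', Finset.mem_univ, if_true]
  have h2 := SchwartzMap.laplacian_eq_sum (EuclideanSpace.basisFun (Fin 3) ℝ)
    (∂_{basisVec a} ζ : 𝓢(E3, ℂ))
  simp only [EuclideanSpace.basisFun_apply] at h2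
  rw [← h2, sub_eq_zero]
  refine schwartz_ext_fourier fun ξ => ?_
  simp only [fourier_lineDeriv_apply, fourier_laplacian_apply]
  ring

lemma hasCompactSupport_lineDeriv {ζ : 𝓢(E3, ℂ)} (h : HasCompactSupport ζ) (m : E3) :
    HasCompactSupport (∂_{m} ζ : 𝓢(E3, ℂ)) :=
  h.mono' ((subset_tsupport _).trans (SchwartzMap.tsupport_lineDerivOp_subset _ _))

lemma hasCompactSupport_curlCurl {ζ : 𝓢(E3, ℂ)} (h : HasCompactSupport ζ) (a i : Fin 3) :
    HasCompactSupport (curlCurl a ζ i) := by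
  have h1 := hasCompactSupport_lineDeriv (hasCompactSupport_lineDeriv h (basisVec a)) (basisVec i)
  have h2 := hasCompactSupport_laplacian h
  rw [curlCurl]
  split_ifs
  · exact h1.sub h2
  · rw [sub_zero]
    exact h1

lemma integrable_smul_of_continuous {ζ : 𝓢(E3, ℂ)} (hζ : HasCompactSupport ζ)
    {f : E3 → ℝ} (hf : Continuous f) :
    Integrable (fun x => f x • ζ x) :=
  (hf.smul ζ.continuous).integrable_of_hasCompactSupport
    (hζ.mono fun x hx h0 => hx (by
      change f x • ζ x = 0
      rw [h0, smul_zero]))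

lemma pairing_fun_sub {ζ : 𝓢(E3, ℂ)} (hζ : HasCompactSupport ζ)
    {f g : E3 → ℝ} (hf : Continuous f) (hg : Continuous g) :
    pairing (fun x => f x - g x) ζ = pairing f ζ - pairing g ζ := by
  rw [pairing, pairing, pairing, ← integral_sub (integrable_smul_of_continuous hζ hf)
    (integrable_smul_of_continuous hζ hg)]
  simp only [sub_smul]

lemma pairing_fun_sum {ζ : 𝓢(E3, ℂ)} (hζ : HasCompactSupport ζ)
    {ι : Type*} (s : Finset ι) {f : ι → E3 → ℝ}
    (hf : ∀ i ∈ s, Continuous (f i)) :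
    pairing (fun x => ∑ i ∈ s, f i x) ζ = ∑ i ∈ s, pairing (f i) ζ := by
  simp only [pairing, Finset.sum_smul]
  exact integral_finsetSum s fun i hi => integrable_smul_of_continuous hζ (hf i hi)

lemma pairing_fun_const_mul (c : ℝ) (f : E3 → ℝ) (ζ : 𝓢(E3, ℂ)) :
    pairing (fun x => c * f x) ζ = c * pairing f ζ := by
  rw [pairing, pairing, ← integral_const_mul]
  refine integral_congr_ae (Eventually.of_forall fun x => ?_)
  simp only [Complex.real_smul]
  push_cast
  ring

lemma continuous_partialD {F : Type*} [NormedAddCommGroup F] [NormedSpace ℝ F] {f : E3 → F}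
    (hf : ContDiff ℝ 1 f) (j : Fin 3) : Continuous (partialD j f) :=
  (hf.continuous_fderiv one_ne_zero).clm_apply continuous_const

/-- Integration by parts against a compactly supported Schwartz function. -/
lemma pairing_partialD {ζ : 𝓢(E3, ℂ)} (hζ : HasCompactSupport ζ)
    {f : E3 → ℝ} (hf : ContDiff ℝ 1 f) (j : Fin 3) :
    pairing (partialD j f) ζ = - pairing f (∂_{basisVec j} ζ) := by
  have h := integral_bilinear_fderiv_right_eq_neg_left_of_integrable
    (μ := (volume : Measure E3)) (f := f) (g := ζ) (v := basisVec j)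
    (B := ContinuousLinearMap.lsmul ℝ ℝ)
    (integrable_smul_of_continuous hζ (continuous_partialD hf j))
    (integrable_smul_of_continuous (hasCompactSupport_lineDeriv hζ _) hf.continuous)
    (integrable_smul_of_continuous hζ hf.continuous)
    (fun x _ => hf.differentiable one_ne_zero x) (fun x _ => ζ.differentiable x)
  rw [← neg_eq_iff_eq_neg]
  exact h.symm

lemma contDiff_coord {v : E3 → E3} {n : WithTop ℕ∞} (hv : ContDiff ℝ n v) (i : Fin 3) :
    ContDiff ℝ n fun x => v x i :=
  (EuclideanSpace.proj (𝕜 := ℝ) i : E3 →L[ℝ] ℝ).contDiff.comp hv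

lemma partialD_coord {v : E3 → E3} {x : E3} (hv : DifferentiableAt ℝ v x) (i j : Fin 3) :
    partialD j (fun y => v y i) x = partialD j v x i := by
  have h := ((EuclideanSpace.proj (𝕜 := ℝ) i : E3 →L[ℝ] ℝ).hasFDerivAt (x := v x)).comp x
    hv.hasFDerivAt
  have h2 : fderiv ℝ (fun y => v y i) x =
      (EuclideanSpace.proj (𝕜 := ℝ) i : E3 →L[ℝ] ℝ).comp (fderiv ℝ v x) := h.fderiv
  rw [partialD, partialD, h2]
  rfl

lemma contDiff_partialD {F : Type*} [NormedAddCommGroup F] [NormedSpace ℝ F] {f : E3 → F}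
    (hf : ContDiff ℝ 2 f) (j : Fin 3) : ContDiff ℝ 1 (partialD j f) :=
  (hf.fderiv_right (m := 1) (by norm_num)).clm_apply contDiff_const

lemma laplacian_coord {v : E3 → E3} (hv : ContDiff ℝ 2 v) (i : Fin 3) (x : E3) :
    (Laplacian.laplacian v x) i = ∑ j : Fin 3, partialD j (partialD j fun y => v y i) x := by
  have h1 : Laplacian.laplacian (fun y => v y i) x = (Laplacian.laplacian v x) i :=
    hv.contDiffAt.laplacian_CLM_comp_left (l := (EuclideanSpace.proj (𝕜 := ℝ) i : E3 →L[ℝ] ℝ))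
  have hf := contDiff_coord hv i
  rw [← h1, InnerProductSpace.laplacian_eq_iteratedFDeriv_orthonormalBasis _
    (EuclideanSpace.basisFun (Fin 3) ℝ)]
  refine Finset.sum_congr rfl fun j _ => ?_
  rw [iteratedFDeriv_two_apply]
  simp only [EuclideanSpace.basisFun_apply, Matrix.cons_val_zero, Matrix.cons_val_one]
  have h3 : DifferentiableAt ℝ (fderiv ℝ fun y => v y i) x :=
    (hf.fderiv_right (m := 1) (by norm_num)).differentiable one_ne_zero x
  have h4 := (h3.hasFDerivAt.clm_apply (hasFDerivAt_const (basisVec j) x)).fderiv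
  have h5 : partialD j (fun y => v y i) = fun y => fderiv ℝ (fun y => v y i) y (basisVec j) := rfl
  rw [h5, partialD, h4]
  simp

lemma pairing_laplacian {v : E3 → E3} (hv : ContDiff ℝ 2 v) (i : Fin 3)
    {ζ : 𝓢(E3, ℂ)} (hζ : HasCompactSupport ζ) :
    pairing (fun x => Laplacian.laplacian v x i) ζ = pairing (fun x => v x i) (Δ ζ) := by
  have hf := contDiff_coord hv i
  have h1 : (fun x => Laplacian.laplacian v x i) =
      fun x => ∑ j : Fin 3, partialD j (partialD j fun y => v y i) x :=
    funext fun x => laplacian_coord hv i x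
  have hcont : Continuous fun x => v x i := hf.continuous
  rw [h1, pairing_fun_sum hζ _ fun j _ => continuous_partialD (contDiff_partialD hf j) j,
    SchwartzMap.laplacian_eq_sum (EuclideanSpace.basisFun (Fin 3) ℝ)]
  simp only [EuclideanSpace.basisFun_apply]
  have h2 : ∀ j : Fin 3, pairing (partialD j (partialD j fun y => v y i)) ζ =
      pairing (fun x => v x i) (∂_{basisVec j} (∂_{basisVec j} ζ)) := fun j => by
    rw [pairing_partialD hζ (contDiff_partialD hf j),
      pairing_partialD (hasCompactSupport_lineDeriv hζ _) (hf.of_le (by norm_num)), neg_neg]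
  simp only [h2]
  simp only [pairing, sum_apply, Finset.smul_sum]
  exact (integral_finsetSum _ fun j _ => integrable_smul_of_continuous
    (hasCompactSupport_lineDeriv (hasCompactSupport_lineDeriv hζ _) _) hcont).symm

/-- This eliminates the pressure. Compact support of `ζ` is what makes any decay of `q` unnecessary.
-/
lemma sum_pairing_gradient_curlCurl {q : E3 → ℝ} (hq : ContDiff ℝ 1 q) (a : Fin 3)
    {ζ : 𝓢(E3, ℂ)} (hζ : HasCompactSupport ζ) :
    ∑ i : Fin 3, pairing (partialD i q) (curlCurl a ζ i) = 0 := by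
  have h : ∀ i : Fin 3, pairing (partialD i q) (curlCurl a ζ i) =
      - pairing q (∂_{basisVec i} (curlCurl a ζ i)) := fun i =>
    pairing_partialD (hasCompactSupport_curlCurl hζ a i) hq i
  simp only [h, Finset.sum_neg_distrib, neg_eq_zero]
  simp only [pairing]
  rw [← integral_finsetSum _ fun i _ => integrable_smul_of_continuous
    (hasCompactSupport_lineDeriv (hasCompactSupport_curlCurl hζ a i) _) hq.continuous]
  simp only [← Finset.smul_sum]
  have h2 : ∀ x, ∑ i : Fin 3, (∂_{basisVec i} (curlCurl a ζ i) : 𝓢(E3, ℂ)) x = 0 := fun x => by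
    rw [← sum_apply, sum_lineDeriv_curlCurl, zero_apply]
  simp only [h2, smul_zero, integral_zero]

/-- The part `∇ div` of `curl curl` pairs to zero with a divergence free `v`. Only the component `a`
remains, so each component obeys its own scalar identity. -/
lemma sum_pairing_curlCurl {v : E3 → E3} (hv : ContDiff ℝ 1 v) (hdiv : ∀ x, divergence v x = 0)
    (a : Fin 3) {ζ : 𝓢(E3, ℂ)} (hζ : HasCompactSupport ζ) :
    ∑ i : Fin 3, pairing (fun x => v x i) (curlCurl a ζ i) =
      - pairing (fun x => v x a) (Δ ζ) := by
  have hc : ∀ i, Continuous fun x => v x i := fun i => (contDiff_coord hv i).continuous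
  have hcs := hasCompactSupport_lineDeriv hζ (basisVec a)
  have h1 : ∀ i : Fin 3, pairing (fun x => v x i) (curlCurl a ζ i) =
      pairing (fun x => v x i) (∂_{basisVec i} (∂_{basisVec a} ζ)) -
        if i = a then pairing (fun x => v x a) (Δ ζ) else 0 := by
    intro i
    rw [curlCurl]
    split_ifs with hi
    · subst hi
      simp only [pairing]
      rw [← integral_sub (integrable_smul_of_continuous
        (hasCompactSupport_lineDeriv hcs _) (hc i))
        (integrable_smul_of_continuous (hasCompactSupport_laplacian hζ) (hc i))]
      simp only [sub_apply, smul_sub]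
    · rw [sub_zero, sub_zero]
  have h2 : ∀ i : Fin 3, pairing (fun x => v x i) (∂_{basisVec i} (∂_{basisVec a} ζ)) =
      - pairing (partialD i fun x => v x i) (∂_{basisVec a} ζ) := fun i => by
    rw [pairing_partialD hcs (contDiff_coord hv i), neg_neg]
  have h3 : ∑ i : Fin 3, pairing (partialD i fun x => v x i) (∂_{basisVec a} ζ) = 0 := by
    rw [← pairing_fun_sum hcs _ fun i _ => continuous_partialD (contDiff_coord hv i) i]
    have : (fun x => ∑ i : Fin 3, partialD i (fun y => v y i) x) = fun _ => 0 := by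
      funext x
      rw [← hdiv x, divergence]
      exact Finset.sum_congr rfl fun i _ => partialD_coord (hv.differentiable one_ne_zero x) i i
    rw [this]
    simp [pairing]
  simp only [h1, h2, Finset.sum_sub_distrib, Finset.sum_neg_distrib, h3, neg_zero, zero_sub,
    Finset.sum_ite_eq', Finset.mem_univ, if_true]

lemma gradient_coord (q : E3 → ℝ) (x : E3) (i : Fin 3) :
    gradient q x i = partialD i q x := by
  have h : inner ℝ (gradient q x) (basisVec i) = fderiv ℝ q x (basisVec i) := by
    rw [gradient, InnerProductSpace.toDual_symm_apply]
  rw [partialD, ← h, EuclideanSpace.inner_single_right]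
  simp

/-- The momentum equation tested against `curl curl (ζ e_a)`. -/
lemma sum_pairing_momentum {ν : ℝ} {v W z : E3 → E3} {N : Fin 3 → E3 → E3} {q : E3 → ℝ}
    (hv : ContDiff ℝ 2 v) (hvdiv : ∀ x, divergence v x = 0)
    (hW : ContDiff ℝ 1 W) (hWdiv : ∀ x, divergence W x = 0)
    (hN : ∀ j, ContDiff ℝ 1 (N j)) (hq : ContDiff ℝ 1 q)
    (hmom : ∀ x, z x + convection W v x - ν • Laplacian.laplacian v x
      - ∑ j : Fin 3, partialD j (N j) x + gradient q x = 0)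
    (a : Fin 3) {ζ : 𝓢(E3, ℂ)} (hζ : HasCompactSupport ζ) :
    ∑ i : Fin 3, pairing (fun x => z x i) (curlCurl a ζ i) =
      ∑ i : Fin 3, ∑ j : Fin 3, pairing (fun x => W x j * v x i - N j x i)
        (∂_{basisVec j} (curlCurl a ζ i)) - ν * pairing (fun x => v x a) (Δ (Δ ζ)) := by
  have hv1 : ContDiff ℝ 1 v := hv.of_le (by norm_num)
  have hP : ∀ i j, ContDiff ℝ 1 fun x => W x j * v x i - N j x i := fun i j =>
    ((contDiff_coord hW j).mul (contDiff_coord hv1 i)).sub (contDiff_coord (hN j) i)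
  have hLc : ∀ i, Continuous fun x => Laplacian.laplacian v x i := fun i => by
    have : (fun x => Laplacian.laplacian v x i) =
        fun x => ∑ j : Fin 3, partialD j (partialD j fun y => v y i) x :=
      funext fun x => laplacian_coord hv i x
    rw [this]
    exact continuous_finsetSum _ fun j _ =>
      continuous_partialD (contDiff_partialD (contDiff_coord hv i) j) j
  have hz : ∀ i, (fun x => z x i) = fun x => (ν * Laplacian.laplacian v x i -
      ∑ j : Fin 3, partialD j (fun x => W x j * v x i - N j x i) x) - partialD i q x := by
    intro i
    funext x
    have h1 := congrArg (fun y : E3 => y i) (hmom x)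
    have hWd := hW.differentiable one_ne_zero x
    have hvd := hv1.differentiable one_ne_zero x
    -- Since `div W = 0`, the convection term is the divergence of `W_j v_i`. All derivatives can
    -- thus fall on the test field, and no bound on `∇ v` is required.
    have h2 : ∀ j : Fin 3, partialD j (fun x => W x j * v x i - N j x i) x =
        W x j * partialD j v x i + v x i * partialD j W x j - partialD j (N j) x i := by
      intro j
      have hWj := (contDiff_coord hW j).differentiable one_ne_zero x
      have hvi := (contDiff_coord hv1 i).differentiable one_ne_zero x
      have hNi := (contDiff_coord (hN j) i).differentiable one_ne_zero x
      rw [← partialD_coord hvd i j, ← partialD_coord hWd j j,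
        ← partialD_coord ((hN j).differentiable one_ne_zero x) i j]
      have := ((hWj.hasFDerivAt.mul hvi.hasFDerivAt).sub hNi.hasFDerivAt).fderiv
      simp only [partialD]
      erw [this]
      simp
    have h3 : ∑ j : Fin 3, v x i * partialD j W x j = 0 := by
      rw [← Finset.mul_sum]
      have := hWdiv x
      rw [divergence] at this
      rw [this, mul_zero]
    have h4 : convection W v x i = ∑ j : Fin 3, W x j * partialD j v x i := by
      simp [convection]
    have h5 : (∑ j : Fin 3, partialD j (N j) x) i = ∑ j : Fin 3, partialD j (N j) x i := by
      simp
    simp only [PiLp.add_apply, PiLp.sub_apply, PiLp.smul_apply, smul_eq_mul, PiLp.zero_apply, h4,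
      h5, gradient_coord] at h1
    simp only [h2, Finset.sum_sub_distrib, Finset.sum_add_distrib, h3]
    linarith
  have hpair : ∀ i, pairing (fun x => z x i) (curlCurl a ζ i) =
      (ν * pairing (fun x => v x i) (curlCurl a (Δ ζ) i) +
        ∑ j : Fin 3, pairing (fun x => W x j * v x i - N j x i)
          (∂_{basisVec j} (curlCurl a ζ i))) - pairing (partialD i q) (curlCurl a ζ i) := by
    intro i
    have hc := hasCompactSupport_curlCurl hζ a i
    have c1 : Continuous fun x =>
        ∑ j : Fin 3, partialD j (fun x => W x j * v x i - N j x i) x :=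
      continuous_finsetSum _ fun j _ => continuous_partialD (hP i j) j
    have c2 : Continuous fun x => ν * Laplacian.laplacian v x i := continuous_const.mul (hLc i)
    have c3 : Continuous fun x => ν * Laplacian.laplacian v x i -
        ∑ j : Fin 3, partialD j (fun x => W x j * v x i - N j x i) x := c2.sub c1
    rw [hz i, pairing_fun_sub hc c3 (continuous_partialD hq i),
      pairing_fun_sub hc c2 c1, pairing_fun_const_mul, pairing_laplacian hv i hc,
      curlCurl_laplacian, pairing_fun_sum hc _ fun j _ => continuous_partialD (hP i j) j]
    congr 1
    rw [sub_eq_add_neg, ← Finset.sum_neg_distrib]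
    congr 1
    refine Finset.sum_congr rfl fun j _ => ?_
    rw [pairing_partialD hc (hP i j), neg_neg]
  simp only [hpair, Finset.sum_sub_distrib, Finset.sum_add_distrib]
  rw [sum_pairing_gradient_curlCurl hq a hζ, ← Finset.mul_sum,
    sum_pairing_curlCurl hv1 hvdiv a (hasCompactSupport_laplacian hζ)]
  ring

end
end RegNSE

/-! ### Convolution estimates -/

namespace RegNSE

noncomputable section

/-- The convolution of a function with a scalar kernel. -/
def kernelConv {F : Type*} [NormedAddCommGroup F] [NormedSpace ℝ F]
    (k : E3 → ℝ) (f : E3 → F) (x : E3) : F := ∫ y, k (x - y) • f y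

section kernelConv

variable {F : Type*} [NormedAddCommGroup F] [NormedSpace ℝ F] {k : E3 → ℝ}

lemma kernelConv_eq_convolution (k : E3 → ℝ) (f : E3 → F) :
    kernelConv k f =
      convolution f k (ContinuousLinearMap.lsmul ℝ ℝ : ℝ →L[ℝ] F →L[ℝ] F).flip volume := rfl

lemma integrable_kernelConv (hk : Continuous k) (hkc : HasCompactSupport k) {f : E3 → F}
    (hf : LocallyIntegrable f) (x : E3) : Integrable fun y => k (x - y) • f y :=
  hkc.convolutionExists_right (ContinuousLinearMap.lsmul ℝ ℝ : ℝ →L[ℝ] F →L[ℝ] F).flip hf hk x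

lemma contDiff_kernelConv [CompleteSpace F] {n : ℕ∞} (hk : ContDiff ℝ n k)
    (hkc : HasCompactSupport k)
    {f : E3 → F} (hf : LocallyIntegrable f) : ContDiff ℝ n (kernelConv k f) := by
  rw [kernelConv_eq_convolution]
  exact hkc.contDiff_convolution_right _ hf hk

lemma partialD_kernelConv [CompleteSpace F] (hk : ContDiff ℝ 1 k) (hkc : HasCompactSupport k)
    {f : E3 → F}
    (hf : LocallyIntegrable f) (j : Fin 3) (x : E3) :
    partialD j (kernelConv k f) x = kernelConv (partialD j k) f x := by
  have h := (hkc.hasFDerivAt_convolution_right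
    (ContinuousLinearMap.lsmul ℝ ℝ : ℝ →L[ℝ] F →L[ℝ] F).flip hf hk x).fderiv
  rw [partialD, kernelConv_eq_convolution, h]
  exact convolution_precompR_apply _ hf (hkc.fderiv ℝ) (hk.continuous_fderiv one_ne_zero) _ _

lemma kernelConv_coord (hk : Continuous k) (hkc : HasCompactSupport k) {f : E3 → E3}
    (hf : LocallyIntegrable f) (x : E3) (i : Fin 3) :
    kernelConv k f x i = kernelConv k (fun y => f y i) x := by
  have := (EuclideanSpace.proj (𝕜 := ℝ) i : E3 →L[ℝ] ℝ).integral_comp_comm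
    (integrable_kernelConv hk hkc hf x)
  exact this.symm

lemma kernelConv_sub (hk : Continuous k) (hkc : HasCompactSupport k) {f g : E3 → F}
    (hf : LocallyIntegrable f) (hg : LocallyIntegrable g) (x : E3) :
    kernelConv k (fun y => f y - g y) x = kernelConv k f x - kernelConv k g x := by
  rw [kernelConv, kernelConv, kernelConv, ← integral_sub (integrable_kernelConv hk hkc hf x)
    (integrable_kernelConv hk hkc hg x)]
  simp only [smul_sub]

lemma enorm_kernelConv_le (k : E3 → ℝ) (f : E3 → F) (x : E3) :
    ‖kernelConv k f x‖ₑ ≤ ∫⁻ y, ‖k (x - y)‖ₑ * ‖f y‖ₑ :=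
  (enorm_integral_le_lintegral_enorm _).trans_eq (lintegral_congr fun _ => enorm_smul _ _)

lemma enorm_kernelConv_le_of_bound (k : E3 → ℝ) {f : E3 → F} {B : ℝ≥0∞}
    (hk : Measurable k) (hf : ∀ y, ‖f y‖ₑ ≤ B) (x : E3) :
    ‖kernelConv k f x‖ₑ ≤ (∫⁻ y, ‖k y‖ₑ) * B := by
  refine (enorm_kernelConv_le k f x).trans ?_
  calc ∫⁻ y, ‖k (x - y)‖ₑ * ‖f y‖ₑ ≤ ∫⁻ y, ‖k (x - y)‖ₑ * B := by
        exact lintegral_mono fun y => mul_le_mul_right (hf y) _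
    _ = (∫⁻ y, ‖k (x - y)‖ₑ) * B :=
        lintegral_mul_const _ (hk.comp (measurable_const.sub measurable_id)).enorm
    _ = _ := by rw [lintegral_sub_left_eq_self (fun y => ‖k y‖ₑ) x]

/-- Cauchy–Schwarz for the splitting `α β = α^{1/2} · (α^{1/2} β)`. -/
lemma sq_lintegral_mul_le {α β : E3 → ℝ≥0∞} (hα : Measurable α) (hβ : Measurable β) :
    (∫⁻ y, α y * β y) ^ (2 : ℝ) ≤ (∫⁻ y, α y) * ∫⁻ y, α y * β y ^ (2 : ℝ) := by
  have h := ENNReal.lintegral_mul_le_Lp_mul_Lq (volume : Measure E3) Real.HolderConjugate.two_two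
    (f := fun y => α y ^ (1 / 2 : ℝ)) (g := fun y => α y ^ (1 / 2 : ℝ) * β y)
    (hα.pow_const _).aemeasurable ((hα.pow_const _).mul hβ).aemeasurable
  have e0 : ∀ x : ℝ≥0∞, (x ^ (1 / 2 : ℝ)) ^ (2 : ℝ) = x := fun x => by
    rw [← ENNReal.rpow_mul]; norm_num
  have e1 : ∀ y, ((fun y => α y ^ (1 / 2 : ℝ)) * fun y => α y ^ (1 / 2 : ℝ) * β y) y =
      α y * β y := fun y => by
    rw [Pi.mul_apply, ← mul_assoc, ← ENNReal.rpow_add_of_nonneg _ _ (by norm_num) (by norm_num)]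
    norm_num
  have e2 : ∀ y, (α y ^ (1 / 2 : ℝ) * β y) ^ (2 : ℝ) = α y * β y ^ (2 : ℝ) := fun y => by
    rw [ENNReal.mul_rpow_of_nonneg _ _ (by norm_num), e0]
  simp only [e1, e2, e0] at h
  calc _ ≤ ((∫⁻ y, α y) ^ (1 / 2 : ℝ) * (∫⁻ y, α y * β y ^ (2 : ℝ)) ^ (1 / 2 : ℝ)) ^ (2 : ℝ) :=
        ENNReal.rpow_le_rpow h (by norm_num)
    _ = _ := by rw [ENNReal.mul_rpow_of_nonneg _ _ (by norm_num), e0, e0]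

/-- Young's inequality for the convolution of an integrable kernel with an `L²` function. -/
lemma eLpNorm_kernelConv_le (hk : Measurable k) {f : E3 → F} (hf : StronglyMeasurable f) :
    eLpNorm (kernelConv k f) 2 (volume : Measure E3) ≤
      (∫⁻ y, ‖k y‖ₑ) * eLpNorm f 2 (volume : Measure E3) := by
  have hfm : Measurable fun y => ‖f y‖ₑ := hf.enorm
  have hkm : Measurable fun y => ‖k y‖ₑ := hk.enorm
  set c := ∫⁻ y, ‖k y‖ₑ with hc
  rw [eLpNorm_eq_lintegral_rpow_enorm_toReal two_ne_zero ENNReal.ofNat_ne_top,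
    eLpNorm_eq_lintegral_rpow_enorm_toReal two_ne_zero ENNReal.ofNat_ne_top]
  simp only [ENNReal.toReal_ofNat]
  have e0 : ∀ x : ℝ≥0∞, (x ^ (2 : ℝ)) ^ (1 / 2 : ℝ) = x := fun x => by
    rw [← ENNReal.rpow_mul]; norm_num
  have h1 : ∫⁻ x, ‖kernelConv k f x‖ₑ ^ (2 : ℝ) ≤ c ^ (2 : ℝ) * ∫⁻ y, ‖f y‖ₑ ^ (2 : ℝ) := by
    calc ∫⁻ x, ‖kernelConv k f x‖ₑ ^ (2 : ℝ)
        ≤ ∫⁻ x, c * ∫⁻ y, ‖k (x - y)‖ₑ * ‖f y‖ₑ ^ (2 : ℝ) := by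
          refine lintegral_mono fun x => ?_
          refine (ENNReal.rpow_le_rpow (enorm_kernelConv_le k f x) (by norm_num)).trans ?_
          have hm : Measurable fun y => ‖k (x - y)‖ₑ :=
            hkm.comp (measurable_const.sub measurable_id)
          refine (sq_lintegral_mul_le hm hfm).trans_eq ?_
          rw [hc, lintegral_sub_left_eq_self (fun y => ‖k y‖ₑ) x]
      _ = c * ∫⁻ x, ∫⁻ y, ‖k (x - y)‖ₑ * ‖f y‖ₑ ^ (2 : ℝ) := by
          refine lintegral_const_mul c ?_
          exact Measurable.lintegral_prod_right'
            (f := fun p : E3 × E3 => ‖k (p.1 - p.2)‖ₑ * ‖f p.2‖ₑ ^ (2 : ℝ))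
            ((hkm.comp (measurable_fst.sub measurable_snd)).mul
              ((hfm.comp measurable_snd).pow_const _))
      _ = c * ∫⁻ y, ∫⁻ x, ‖k (x - y)‖ₑ * ‖f y‖ₑ ^ (2 : ℝ) := by
          rw [lintegral_lintegral_swap]
          exact ((hkm.comp (measurable_fst.sub measurable_snd)).mul
              ((hfm.comp measurable_snd).pow_const _)).aemeasurable
      _ = c * ∫⁻ y, c * ‖f y‖ₑ ^ (2 : ℝ) := by
          congr 1
          refine lintegral_congr fun y => ?_
          have hm : Measurable fun x => ‖k (x - y)‖ₑ :=
            hkm.comp (measurable_id.sub measurable_const)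
          rw [lintegral_mul_const _ hm, lintegral_sub_right_eq_self (fun x => ‖k x‖ₑ) y]
      _ = _ := by
          rw [lintegral_const_mul _ (hfm.pow_const _), ← mul_assoc]
          norm_num [pow_two]
  calc _ ≤ (c ^ (2 : ℝ) * ∫⁻ y, ‖f y‖ₑ ^ (2 : ℝ)) ^ (1 / 2 : ℝ) :=
        ENNReal.rpow_le_rpow h1 (by norm_num)
    _ = _ := by rw [ENNReal.mul_rpow_of_nonneg _ _ (by norm_num), e0]

/-- Convolution preserves incompressibility. -/
lemma divergence_kernelConv (hk : ContDiff ℝ 1 k) (hkc : HasCompactSupport k) {v : E3 → E3}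
    (hv : ContDiff ℝ 1 v) (hdiv : ∀ x, divergence v x = 0) (x : E3) :
    divergence (kernelConv k v) x = 0 := by
  have hvl : LocallyIntegrable v := hv.continuous.locallyIntegrable
  have hkx : ContDiff ℝ 1 fun y => k (x - y) := hk.comp (contDiff_const.sub contDiff_id)
  have hkxc : HasCompactSupport fun y => k (x - y) :=
    hkc.comp_homeomorph (Homeomorph.subLeft x)
  have hder : ∀ (j : Fin 3) (y : E3),
      fderiv ℝ (fun y => k (x - y)) y (basisVec j) = - partialD j k (x - y) := by
    intro j y
    have h1 := (hk.differentiable one_ne_zero (x - y)).hasFDerivAt.comp y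
      ((hasFDerivAt_id y).const_sub x)
    have h2 : fderiv ℝ (fun y => k (x - y)) y =
      (fderiv ℝ k (x - y)).comp (-ContinuousLinearMap.id ℝ E3) := h1.fderiv
    rw [h2, partialD]
    simp
  have hint : ∀ {g h : E3 → ℝ}, Continuous g → Continuous h → HasCompactSupport h →
      Integrable (fun y => g y • h y) := fun hg hh hc =>
    (hg.smul hh).integrable_of_hasCompactSupport hc.smul_left
  have key : ∀ j : Fin 3, partialD j (kernelConv k v) x j =
      ∫ y, partialD j (fun y => v y j) y • k (x - y) := by
    intro j
    have hc := contDiff_coord hv j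
    have c1 : Continuous (fun y => fderiv ℝ (fun y => k (x - y)) y (basisVec j)) :=
      (hkx.continuous_fderiv one_ne_zero).clm_apply continuous_const
    have c2 : HasCompactSupport (fun y => fderiv ℝ (fun y => k (x - y)) y (basisVec j)) :=
      hkxc.fderiv_apply ℝ (basisVec j)
    -- The derivative passes from the kernel to `v`; the sign of the integration by parts is
    -- absorbed by the reflection in `k (x - y)`.
    have h := integral_smul_fderiv_eq_neg_fderiv_smul_of_integrable (𝕜 := ℝ)
      (μ := (volume : Measure E3)) (f := fun y => v y j) (g := fun y => k (x - y))
      (v := basisVec j)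
      (hint (continuous_partialD hc j) hkx.continuous hkxc)
      (hint hc.continuous c1 c2) (hint hc.continuous hkx.continuous hkxc)
      (fun y _ => hc.differentiable one_ne_zero y) (fun y _ => hkx.differentiable one_ne_zero y)
    rw [partialD_kernelConv hk hkc hvl, kernelConv_coord (continuous_partialD hk j)
      (hkc.fderiv_apply ℝ _) hvl, kernelConv]
    rw [← neg_eq_iff_eq_neg, ← integral_neg] at h
    refine Eq.trans (integral_congr_ae (Eventually.of_forall fun y => ?_)) h
    simp only [hder, smul_eq_mul]
    ring
  rw [divergence]
  simp only [key]
  rw [← integral_finsetSum _ fun j _ =>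
    hint (continuous_partialD (contDiff_coord hv j) j) hkx.continuous hkxc]
  have h0 : ∀ y, ∑ j : Fin 3, partialD j (fun y => v y j) y • k (x - y) = 0 := fun y => by
    rw [← Finset.sum_smul]
    have : ∑ j : Fin 3, partialD j (fun y => v y j) y = divergence v y :=
      Finset.sum_congr rfl fun j _ => partialD_coord (hv.differentiable one_ne_zero y) j j
    rw [this, hdiv, zero_smul]
  simp only [h0, integral_zero]

end kernelConv

end
end RegNSE

/-! ### Lipschitz dependence of the momentum flux on the velocity -/

namespace RegNSE

noncomputable section

lemma contDiff_rescale {ρ : E3 → ℝ} (hρ : ContDiff ℝ ∞ ρ) (ε : ℝ) :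
    ContDiff ℝ ∞ (rescale ρ ε) :=
  contDiff_const.mul (hρ.comp (contDiff_const_smul _))

lemma hasCompactSupport_rescale {ρ : E3 → ℝ} (hρ : HasCompactSupport ρ) {ε : ℝ} (hε : ε ≠ 0) :
    HasCompactSupport (rescale ρ ε) :=
  (hρ.comp_smul (inv_ne_zero hε)).mul_left

lemma lintegral_enorm_ne_top {k : E3 → ℝ} (hk : Continuous k) (hkc : HasCompactSupport k) :
    ∫⁻ y, ‖k y‖ₑ ≠ ⊤ :=
  (hk.integrable_of_hasCompactSupport hkc).2.ne

/-- The tensor whose divergence is the eddy viscosity term. -/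
def eddyFlux (k : E3 → ℝ) (a : E3 → ℝ) (v : E3 → E3) (j : Fin 3) : E3 → E3 :=
  kernelConv k fun y => a y • partialD j (kernelConv k v) y

section flux

variable {k : E3 → ℝ}

lemma locallyIntegrable_smul_partialD (hk : ContDiff ℝ ∞ k) (hkc : HasCompactSupport k)
    (a : Lp ℝ ∞ (volume : Measure E3)) {v : E3 → E3} (hv : Continuous v) (j : Fin 3) :
    LocallyIntegrable fun y => a y • partialD j (kernelConv k v) y := by
  have ha : LocallyIntegrable a := (Lp.memLp a).locallyIntegrable le_top
  have hc : ContDiff ℝ 1 (kernelConv k v) :=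
    contDiff_kernelConv (n := 1) (hk.of_le (mod_cast le_top)) hkc hv.locallyIntegrable
  exact ha.smul_continuous (continuous_partialD hc j)

lemma contDiff_eddyFlux (hk : ContDiff ℝ ∞ k) (hkc : HasCompactSupport k)
    (a : Lp ℝ ∞ (volume : Measure E3)) {v : E3 → E3} (hv : Continuous v) (j : Fin 3) :
    ContDiff ℝ 1 (eddyFlux k a v j) :=
  contDiff_kernelConv (n := 1) (hk.of_le (mod_cast le_top)) hkc
    (locallyIntegrable_smul_partialD hk hkc a hv j)

/-- The inner derivative is put on the kernel, so the difference involves no derivative of `v₁ - v₂`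
and can be bounded by its `L²` norm alone. -/
lemma eddyFlux_sub (hk : ContDiff ℝ ∞ k) (hkc : HasCompactSupport k)
    (a : Lp ℝ ∞ (volume : Measure E3)) {v₁ v₂ : E3 → E3} (hv₁ : Continuous v₁)
    (hv₂ : Continuous v₂) (j : Fin 3) (x : E3) :
    eddyFlux k a v₁ j x - eddyFlux k a v₂ j x =
      kernelConv k (fun y => a y • kernelConv (partialD j k) (fun z => v₁ z - v₂ z) y) x := by
  have hk1 : ContDiff ℝ 1 k := hk.of_le (mod_cast le_top)
  rw [eddyFlux, eddyFlux, ← kernelConv_sub hk.continuous hkc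
    (locallyIntegrable_smul_partialD hk hkc a hv₁ j)
    (locallyIntegrable_smul_partialD hk hkc a hv₂ j)]
  congr 1
  funext y
  rw [partialD_kernelConv hk1 hkc hv₁.locallyIntegrable,
    partialD_kernelConv hk1 hkc hv₂.locallyIntegrable, ← smul_sub,
    ← kernelConv_sub (continuous_partialD hk1 j) (hkc.fderiv_apply ℝ _)
      hv₁.locallyIntegrable hv₂.locallyIntegrable]

lemma eLpNorm_eddyFlux_sub_le (hk : ContDiff ℝ ∞ k) (hkc : HasCompactSupport k)
    (a : Lp ℝ ∞ (volume : Measure E3)) {v₁ v₂ : E3 → E3} (hv₁ : Continuous v₁)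
    (hv₂ : Continuous v₂) (j : Fin 3) :
    eLpNorm (fun x => eddyFlux k a v₁ j x - eddyFlux k a v₂ j x) 2 (volume : Measure E3) ≤
      (∫⁻ y, ‖k y‖ₑ) * (‖a‖ₑ * (∫⁻ y, ‖partialD j k y‖ₑ)) *
        eLpNorm (fun x => v₁ x - v₂ x) 2 (volume : Measure E3) := by
  have hk1 : ContDiff ℝ 1 k := hk.of_le (mod_cast le_top)
  have hw : Continuous fun x => v₁ x - v₂ x := hv₁.sub hv₂
  have hcont : Continuous (kernelConv (partialD j k) fun z => v₁ z - v₂ z) :=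
    (contDiff_kernelConv (n := 0) (contDiff_zero.2 (continuous_partialD hk1 j))
      (hkc.fderiv_apply ℝ _) hw.locallyIntegrable).continuous
  have hsm : StronglyMeasurable fun y =>
      a y • kernelConv (partialD j k) (fun z => v₁ z - v₂ z) y :=
    (Lp.stronglyMeasurable a).smul hcont.stronglyMeasurable
  simp only [eddyFlux_sub hk hkc a hv₁ hv₂]
  refine (eLpNorm_kernelConv_le hk.continuous.measurable hsm).trans ?_
  rw [mul_assoc, mul_assoc]
  refine mul_le_mul_right ?_ _
  have ha : ∀ᵐ y, ‖a y‖ₑ ≤ ‖a‖ₑ := by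
    rw [Lp.enorm_def, eLpNorm_exponent_top]
    exact ae_le_eLpNormEssSup
  refine (eLpNorm_le_mul_eLpNorm_of_ae_le_mul'' 2 hcont.aestronglyMeasurable (c := ‖a‖ₑ) ?_).trans
    (mul_le_mul_right (eLpNorm_kernelConv_le (continuous_partialD hk1 j).measurable
      hw.stronglyMeasurable) _)
  filter_upwards [ha] with y hy
  rw [enorm_smul]
  exact mul_le_mul_left hy _

/-- The momentum flux depends on the velocity in a Lipschitz way for the `L²` norm. -/
lemma eLpNorm_flux_sub_le (hk : ContDiff ℝ ∞ k) (hkc : HasCompactSupport k)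
    (a : Lp ℝ ∞ (volume : Measure E3)) {v₁ v₂ : E3 → E3} (hv₁ : Continuous v₁)
    (hv₂ : Continuous v₂) {B : ℝ≥0∞} (hB₁ : ∀ x, ‖v₁ x‖ₑ ≤ B) (hB₂ : ∀ x, ‖v₂ x‖ₑ ≤ B)
    (i j : Fin 3) :
    eLpNorm (fun x => (kernelConv k v₁ x j * v₁ x i - eddyFlux k a v₁ j x i) -
      (kernelConv k v₂ x j * v₂ x i - eddyFlux k a v₂ j x i)) 2 (volume : Measure E3) ≤
      (2 * B * (∫⁻ y, ‖k y‖ₑ) + (∫⁻ y, ‖k y‖ₑ) * (‖a‖ₑ * (∫⁻ y, ‖partialD j k y‖ₑ))) *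
        eLpNorm (fun x => v₁ x - v₂ x) 2 (volume : Measure E3) := by
  have hk0 := hk.continuous
  have hw : Continuous fun x => v₁ x - v₂ x := hv₁.sub hv₂
  have hconv : ∀ {v : E3 → E3}, Continuous v → Continuous (kernelConv k v) := fun hv =>
    (contDiff_kernelConv (n := 0) (contDiff_zero.2 hk0) hkc hv.locallyIntegrable).continuous
  have hco : ∀ {v : E3 → E3}, Continuous v → ∀ i, Continuous fun x => v x i := fun hv i =>
    (EuclideanSpace.proj (𝕜 := ℝ) i : E3 →L[ℝ] ℝ).continuous.comp hv
  have hle : ∀ (y : E3) (i : Fin 3), ‖y i‖ₑ ≤ ‖y‖ₑ := fun y i => by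
    rw [enorm_le_iff_norm_le]
    exact PiLp.norm_apply_le y i
  set w := fun x => v₁ x - v₂ x with hwdef
  -- Bilinear splitting `w̄ v₁ + v̄₂ w`: each product has one factor bounded in `L^∞` and one
  -- controlled by `w` in `L²`.
  have e : (fun x => (kernelConv k v₁ x j * v₁ x i - eddyFlux k a v₁ j x i) -
      (kernelConv k v₂ x j * v₂ x i - eddyFlux k a v₂ j x i)) =
      (fun x => kernelConv k w x j * v₁ x i) + (fun x => kernelConv k v₂ x j * w x i)
        - (fun x => (eddyFlux k a v₁ j x - eddyFlux k a v₂ j x) i) := by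
    funext x
    have h1 := kernelConv_sub hk0 hkc hv₁.locallyIntegrable hv₂.locallyIntegrable x
    simp only [Pi.add_apply, Pi.sub_apply]
    rw [hwdef, h1]
    simp only [PiLp.sub_apply]
    ring
  have m1 : Continuous fun x => kernelConv k w x j * v₁ x i := (hco (hconv hw) j).mul (hco hv₁ i)
  have m2 : Continuous fun x => kernelConv k v₂ x j * w x i := (hco (hconv hv₂) j).mul (hco hw i)
  have m3c : Continuous fun x => eddyFlux k a v₁ j x - eddyFlux k a v₂ j x :=
    (contDiff_eddyFlux hk hkc a hv₁ j).continuous.sub (contDiff_eddyFlux hk hkc a hv₂ j).continuous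
  have b1 : eLpNorm (fun x => kernelConv k w x j * v₁ x i) 2 (volume : Measure E3) ≤
      B * ((∫⁻ y, ‖k y‖ₑ) * eLpNorm w 2 (volume : Measure E3)) := by
    refine (eLpNorm_le_mul_eLpNorm_of_ae_le_mul'' 2 (hconv hw).aestronglyMeasurable (c := B)
      (Eventually.of_forall fun x => ?_)).trans
      (mul_le_mul_right (eLpNorm_kernelConv_le hk0.measurable hw.stronglyMeasurable) _)
    rw [enorm_mul, mul_comm]
    exact mul_le_mul' ((hle _ _).trans (hB₁ x)) (hle _ _)
  have b2 : eLpNorm (fun x => kernelConv k v₂ x j * w x i) 2 (volume : Measure E3) ≤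
      ((∫⁻ y, ‖k y‖ₑ) * B) * eLpNorm w 2 (volume : Measure E3) := by
    refine eLpNorm_le_mul_eLpNorm_of_ae_le_mul'' 2 hw.aestronglyMeasurable
      (Eventually.of_forall fun x => ?_)
    rw [enorm_mul]
    exact mul_le_mul' ((hle _ _).trans
      (enorm_kernelConv_le_of_bound k hk0.measurable hB₂ x)) (hle _ _)
  have b3 := (eLpNorm_coord_le (fun x => eddyFlux k a v₁ j x - eddyFlux k a v₂ j x) 2 i).trans
    (eLpNorm_eddyFlux_sub_le hk hkc a hv₁ hv₂ j)
  rw [e]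
  refine (eLpNorm_sub_le (m1.add m2).aestronglyMeasurable (hco m3c i).aestronglyMeasurable
    (by norm_num)).trans ?_
  refine (add_le_add ((eLpNorm_add_le m1.aestronglyMeasurable m2.aestronglyMeasurable
    (by norm_num)).trans (add_le_add b1 b2)) b3).trans_eq ?_
  ring

end flux

end
end RegNSE

/-! ### Weak form and pointwise-in-time bounds for regular solutions -/

namespace RegNSE

noncomputable section

lemma isOpen_openTime (T : EReal) : IsOpen (openTime T) :=
  (isOpen_lt continuous_const continuous_id).inter
    (isOpen_lt continuous_coe_real_ereal continuous_const)

lemma Ioo_subset_openTime {T : EReal} {τ : ℝ} (hτ : τ ∈ openTime T) :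
    Set.Ioo 0 τ ⊆ openTime T := fun _ ht =>
  ⟨ht.1, lt_trans (EReal.coe_lt_coe_iff.2 ht.2) hτ.2⟩

/-- Differentiation in time of the pairing with a fixed test function. -/
lemma hasDerivAt_pairing {S : Set ℝ} (hS : IsOpen S) {U : ℝ → E3 → ℝ}
    (hU : ContinuousOn (fun z : ℝ × E3 => U z.1 z.2) (S ×ˢ Set.univ))
    (hd : ∀ t ∈ S, ∀ x, DifferentiableAt ℝ (fun s => U s x) t)
    (hU' : ContinuousOn (fun z : ℝ × E3 => deriv (fun s => U s z.2) z.1) (S ×ˢ Set.univ))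
    {φ : 𝓢(E3, ℂ)} (hφ : HasCompactSupport φ) {t : ℝ} (ht : t ∈ S) :
    HasDerivAt (fun s => pairing (U s) φ) (pairing (fun x => deriv (fun s => U s x) t) φ) t := by
  obtain ⟨δ, hδ, hsub⟩ := Metric.nhds_basis_closedBall.mem_iff.1 (hS.mem_nhds ht)
  have hslice : ∀ {V : ℝ → E3 → ℝ},
      ContinuousOn (fun z : ℝ × E3 => V z.1 z.2) (S ×ˢ Set.univ) →
      ∀ s ∈ S, Continuous (V s) := fun hV s hs =>
    hV.comp_continuous (by fun_prop : Continuous fun x : E3 => (s, x)) fun x => ⟨hs, trivial⟩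
  have hcomp : IsCompact (Metric.closedBall t δ ×ˢ tsupport φ) :=
    (isCompact_closedBall t δ).prod hφ
  obtain ⟨D, hD⟩ := hcomp.exists_bound_of_continuousOn
    (hU'.mono (Set.prod_mono hsub (Set.subset_univ _)))
  have hD' : ∀ s ∈ Metric.closedBall t δ, ∀ x,
      ‖deriv (fun s => U s x) s • φ x‖ ≤ D * ‖φ x‖ := by
    intro s hs x
    by_cases hx : x ∈ tsupport φ
    · rw [norm_smul]
      exact mul_le_mul_of_nonneg_right (hD (s, x) ⟨hs, hx⟩) (norm_nonneg _)
    · rw [image_eq_zero_of_notMem_tsupport hx]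
      simp
  refine (hasDerivAt_integral_of_dominated_loc_of_deriv_le (μ := (volume : Measure E3))
    (F := fun s x => U s x • φ x)
    (F' := fun s x => deriv (fun s => U s x) s • φ x) (bound := fun x => D * ‖φ x‖)
    (Metric.closedBall_mem_nhds t hδ) ?_ (integrable_smul_of_continuous hφ (hslice hU t ht))
    ?_ ?_ ?_ ?_).2
  · filter_upwards [hS.mem_nhds ht] with s hs
    exact (integrable_smul_of_continuous hφ (hslice hU s hs)).1
  · exact (integrable_smul_of_continuous hφ
      (hslice (V := fun s x => deriv (fun s => U s x) s) hU' t ht)).1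
  · exact Eventually.of_forall fun x s hs => hD' s hs x
  · exact φ.integrable.norm.const_mul D
  · exact Eventually.of_forall fun x s hs => (hd s (hsub hs) x).hasDerivAt.smul_const (φ x)

lemma deriv_coord {f : ℝ → E3} {t : ℝ} (hf : DifferentiableAt ℝ f t) (i : Fin 3) :
    HasDerivAt (fun s => f s i) (deriv f t i) t :=
  (EuclideanSpace.proj (𝕜 := ℝ) i : E3 →L[ℝ] ℝ).hasFDerivAt.comp_hasDerivAt t hf.hasDerivAt

namespace IsRegularSolution

variable {ν : ℝ} {A : ℝ → Lp ℝ ∞ (volume : Measure E3)} {ρ : E3 → ℝ} {ε : ℝ} {u₀ : E3 → E3}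
  {T : EReal} {u : ℝ → E3 → E3} {p : ℝ → E3 → ℝ}

lemma hasDerivAt_pairing_coord (h : IsRegularSolution ν A ρ ε u₀ T u p) (i : Fin 3)
    {φ : 𝓢(E3, ℂ)} (hφ : HasCompactSupport φ) {t : ℝ} (ht : t ∈ openTime T) :
    HasDerivAt (fun s => pairing (fun x => u s x i) φ)
      (pairing (fun x => deriv (fun s => u s x) t i) φ) t := by
  have hp : Continuous fun y : E3 => y i := (EuclideanSpace.proj (𝕜 := ℝ) i : E3 →L[ℝ] ℝ).continuous
  have hd : ∀ t ∈ openTime T, ∀ x, deriv (fun s => u s x i) t = deriv (fun s => u s x) t i :=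
    fun t ht x => (deriv_coord (h.differentiableAt_time t ht x) i).deriv
  have := hasDerivAt_pairing (isOpen_openTime T) (U := fun s x => u s x i)
    (hp.comp_continuousOn h.continuousOn_u)
    (fun t ht x => (deriv_coord (h.differentiableAt_time t ht x) i).differentiableAt)
    ((hp.comp_continuousOn h.continuousOn_time_deriv).congr fun z hz => hd z.1 hz.1 z.2) hφ ht
  simpa only [hd t ht] using this

lemma continuous_slice (h : IsRegularSolution ν A ρ ε u₀ T u p) {t : ℝ} (ht : t ∈ openTime T) :
    Continuous (u t) := (h.contDiff_u t ht).continuous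

/-- The weak form of the equations, tested against `curl curl (ζ e_a)`. -/
lemma hasDerivAt_pairing_laplacian (h : IsRegularSolution ν A ρ ε u₀ T u p)
    (hρ : IsMollifier ρ) (hε : 0 < ε) (a : Fin 3) {ζ : 𝓢(E3, ℂ)} (hζ : HasCompactSupport ζ)
    {t : ℝ} (ht : t ∈ openTime T) :
    HasDerivAt (fun s => pairing (fun x => u s x a) (Δ ζ))
      (ν * pairing (fun x => u t x a) (Δ (Δ ζ)) - ∑ i : Fin 3, ∑ j : Fin 3,
        pairing (fun x => kernelConv (rescale ρ ε) (u t) x j * u t x i -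
          eddyFlux (rescale ρ ε) (A t) (u t) j x i) (∂_{basisVec j} (curlCurl a ζ i))) t := by
  have hk := contDiff_rescale hρ.smooth ε
  have hk1 : ContDiff ℝ 1 (rescale ρ ε) := hk.of_le (mod_cast le_top)
  have hkc := hasCompactSupport_rescale hρ.compactSupport hε.ne'
  have hv := h.contDiff_u t ht
  have hv1 : ContDiff ℝ 1 (u t) := hv.of_le (by norm_num)
  -- The pairing with `Δ ζ` is rewritten with the solenoidal field before differentiating, so that
  -- the pressure disappears from the derivative.
  have h1 : ∀ s ∈ openTime T, pairing (fun x => u s x a) (Δ ζ) =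
      - ∑ i : Fin 3, pairing (fun x => u s x i) (curlCurl a ζ i) := fun s hs => by
    rw [sum_pairing_curlCurl ((h.contDiff_u s hs).of_le (by norm_num)) (h.incompressible s hs) a hζ,
      neg_neg]
  have h2 : HasDerivAt (fun s => - ∑ i : Fin 3, pairing (fun x => u s x i) (curlCurl a ζ i))
      (- ∑ i : Fin 3, pairing (fun x => deriv (fun s => u s x) t i) (curlCurl a ζ i)) t :=
    (HasDerivAt.fun_sum fun i _ => h.hasDerivAt_pairing_coord i
      (hasCompactSupport_curlCurl hζ a i) ht).neg
  have h3 := sum_pairing_momentum (ν := ν) (v := u t) (W := kernelConv (rescale ρ ε) (u t))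
    (z := fun x => deriv (fun s => u s x) t) (N := eddyFlux (rescale ρ ε) (A t) (u t)) (q := p t)
    hv (h.incompressible t ht)
    (contDiff_kernelConv (n := 1) hk1 hkc hv.continuous.locallyIntegrable)
    (divergence_kernelConv hk1 hkc hv1 (h.incompressible t ht))
    (fun j => contDiff_eddyFlux hk hkc (A t) hv.continuous j) (h.contDiff_p t ht)
    (fun x => h.momentum t ht x) a hζ
  rw [h3, neg_sub] at h2
  refine h2.congr_of_eventuallyEq ?_
  filter_upwards [(isOpen_openTime T).mem_nhds ht] with s hs
  exact h1 s hs

/-- By continuity, the points of the open slab where the essential bound fails form an open set.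
That set is null, hence empty. -/
lemma exists_enorm_le (h : IsRegularSolution ν A ρ ε u₀ T u p) {τ : ℝ} (hτ : τ ∈ openTime T) :
    ∃ B : ℝ≥0∞, B ≠ ⊤ ∧ ∀ t ∈ Set.Ioo 0 τ, ∀ x, ‖u t x‖ₑ ≤ B := by
  have hm := h.bounded_Linfty τ hτ
  refine ⟨_, hm.2.ne, fun t ht x => ?_⟩
  set μ := (volume : Measure (ℝ × E3)).restrict (Set.Icc (0 : ℝ) τ ×ˢ Set.univ) with hμ
  set f := fun z : ℝ × E3 => u z.1 z.2 with hf
  rw [eLpNorm_exponent_top]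
  have hS : IsOpen (Set.Ioo 0 τ ×ˢ (Set.univ : Set E3)) := isOpen_Ioo.prod isOpen_univ
  have hcont : ContinuousOn (fun z => ‖f z‖ₑ) (Set.Ioo 0 τ ×ˢ (Set.univ : Set E3)) :=
    (h.continuousOn_u.mono (Set.prod_mono (Ioo_subset_openTime hτ) subset_rfl)).enorm
  have hO : IsOpen ((Set.Ioo 0 τ ×ˢ (Set.univ : Set E3)) ∩
      (fun z => ‖f z‖ₑ) ⁻¹' Set.Ioi (eLpNormEssSup f μ)) :=
    hcont.isOpen_inter_preimage hS isOpen_Ioi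
  have hae : ∀ᵐ z ∂μ, ‖f z‖ₑ ≤ eLpNormEssSup f μ := ae_le_eLpNormEssSup
  have hnull : (volume : Measure (ℝ × E3)) ((Set.Ioo 0 τ ×ˢ (Set.univ : Set E3)) ∩
      (fun z => ‖f z‖ₑ) ⁻¹' Set.Ioi (eLpNormEssSup f μ)) = 0 := by
    rw [hμ, ae_restrict_iff' (measurableSet_Icc.prod MeasurableSet.univ), ae_iff] at hae
    refine measure_mono_null ?_ hae
    rintro z ⟨hz1, hz2⟩ hz3
    exact absurd (hz3 ⟨Set.Ioo_subset_Icc_self hz1.1, trivial⟩) (not_le.2 hz2)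
  have hempty := (hO.measure_eq_zero_iff _).1 hnull
  by_contra hlt
  push Not at hlt
  have : ((t, x) : ℝ × E3) ∈ (Set.Ioo 0 τ ×ˢ (Set.univ : Set E3)) ∩
      (fun z => ‖f z‖ₑ) ⁻¹' Set.Ioi (eLpNormEssSup f μ) := ⟨⟨ht, trivial⟩, hlt⟩
  rw [hempty] at this
  exact this

/-- The `L²` bound holds for almost every time, so good times accumulate at `t` from the right.
Fatou's lemma along such a sequence, with pointwise convergence of `u`, gives the bound at every
time. -/
lemma exists_eLpNorm_le (h : IsRegularSolution ν A ρ ε u₀ T u p) {τ : ℝ} (hτ : τ ∈ openTime T) :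
    ∃ C : ℝ≥0∞, C ≠ ⊤ ∧ ∀ t ∈ Set.Ioo 0 τ, eLpNorm (u t) 2 (volume : Measure E3) ≤ C := by
  obtain ⟨C, hC⟩ := h.bounded_L2 τ hτ
  refine ⟨ENNReal.ofReal C, ENNReal.ofReal_ne_top, fun t ht => ?_⟩
  have hfreq : ∃ᶠ s in 𝓝[>] t, eLpNorm (u s) 2 (volume : Measure E3) ≤ ENNReal.ofReal C ∧
      s ∈ Set.Ioo 0 τ := by
    intro hev
    obtain ⟨c, hc, hcs⟩ := (mem_nhdsGT_iff_exists_Ioo_subset).1 hev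
    rw [ae_restrict_iff' measurableSet_Icc, ae_iff] at hC
    have hpos : 0 < volume (Set.Ioo t (min c τ)) := by
      rw [Real.volume_Ioo, ENNReal.ofReal_pos, sub_pos]
      exact lt_min hc ht.2
    refine hpos.ne' (measure_mono_null ?_ hC)
    intro s hs hs'
    have hsI : s ∈ Set.Ioo 0 τ := ⟨ht.1.trans hs.1, hs.2.trans_le (min_le_right _ _)⟩
    exact hcs ⟨hs.1, hs.2.trans_le (min_le_left _ _)⟩ ⟨hs' (Set.Ioo_subset_Icc_self hsI), hsI⟩
  obtain ⟨s, hs, hs'⟩ := exists_seq_forall_of_frequently hfreq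
  have hlim := Lp.eLpNorm_lim_le_liminf_eLpNorm (p := 2) (μ := (volume : Measure E3))
    (f := fun n => u (s n))
    (fun n => (h.continuous_slice (Ioo_subset_openTime hτ (hs' n).2)).aestronglyMeasurable) (u t)
    (Eventually.of_forall fun x => ?_)
  · refine hlim.trans (liminf_le_of_frequently_le' (Eventually.frequently
      (Eventually.of_forall fun n => (hs' n).1)))
  · have hc : ContinuousAt (fun z : ℝ × E3 => u z.1 z.2) (t, x) :=
      h.continuousOn_u.continuousAt (((isOpen_openTime T).prod isOpen_univ).mem_nhds
        ⟨Ioo_subset_openTime hτ ht, trivial⟩)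
    have h1 : Tendsto (fun n => (s n, x)) atTop (𝓝 (t, x)) :=
      (tendsto_nhds_of_tendsto_nhdsWithin hs).prodMk_nhds tendsto_const_nhds
    exact hc.tendsto.comp h1

end IsRegularSolution

end
end RegNSE

/-! ### Uniqueness of the velocity and of the pressure -/

namespace RegNSE

noncomputable section

namespace IsRegularSolution

variable {ν : ℝ} {A : ℝ → Lp ℝ ∞ (volume : Measure E3)} {ρ : E3 → ℝ} {ε : ℝ} {u₀ : E3 → E3}
  {T : EReal} {u₁ u₂ : ℝ → E3 → E3} {p₁ p₂ : ℝ → E3 → ℝ}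

lemma memLp_slice (h : IsRegularSolution ν A ρ ε u₀ T u₁ p₁) {τ : ℝ} (hτ : τ ∈ openTime T)
    {t : ℝ} (ht : t ∈ Set.Ioo 0 τ) : MemLp (u₁ t) 2 := by
  obtain ⟨C, hC, hle⟩ := h.exists_eLpNorm_le hτ
  exact ⟨(h.continuous_slice (Ioo_subset_openTime hτ ht)).aestronglyMeasurable,
    (hle t ht).trans_lt hC.lt_top⟩

/-- The difference of two regular solutions is a weak evolution. -/
lemma exists_isWeakEvolution_sub (h₁ : IsRegularSolution ν A ρ ε u₀ T u₁ p₁)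
    (h₂ : IsRegularSolution ν A ρ ε u₀ T u₂ p₂) (hρ : IsMollifier ρ) (hε : 0 < ε)
    (hA : ∃ M : ℝ, ∀ t : ℝ, 0 ≤ t → ‖A t‖ ≤ M) {τ : ℝ} (hτ : τ ∈ openTime T) :
    ∃ K : ℝ, 0 ≤ K ∧ IsWeakEvolution ν K τ fun s x => u₁ s x - u₂ s x := by
  obtain ⟨B₁, hB₁, hle₁⟩ := h₁.exists_enorm_le hτ
  obtain ⟨B₂, hB₂, hle₂⟩ := h₂.exists_enorm_le hτ
  obtain ⟨M, hM⟩ := hA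
  have hk := contDiff_rescale hρ.smooth ε
  have hk1 : ContDiff ℝ 1 (rescale ρ ε) := hk.of_le (mod_cast le_top)
  have hkc := hasCompactSupport_rescale hρ.compactSupport hε.ne'
  set k := rescale ρ ε with hkdef
  set B := B₁ + B₂ with hB
  set c₀ := ∫⁻ y, ‖k y‖ₑ with hc₀
  -- Summing over `j` lets one constant `K` serve all components of the flux.
  set c₁ := ∑ j : Fin 3, ∫⁻ y, ‖partialD j k y‖ₑ with hc₁
  have hc₀t : c₀ ≠ ⊤ := lintegral_enorm_ne_top hk.continuous hkc
  have hc₁t : c₁ ≠ ⊤ := ENNReal.sum_ne_top.2 fun j _ =>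
    lintegral_enorm_ne_top (continuous_partialD hk1 j) (hkc.fderiv_apply ℝ _)
  set K := 2 * B * c₀ + c₀ * (ENNReal.ofReal M * c₁) with hK
  have hKt : K ≠ ⊤ := by
    have : B ≠ ⊤ := ENNReal.add_ne_top.2 ⟨hB₁, hB₂⟩
    have h2 : (2 : ℝ≥0∞) ≠ ⊤ := ENNReal.ofNat_ne_top
    exact ENNReal.add_ne_top.2 ⟨ENNReal.mul_ne_top (ENNReal.mul_ne_top h2 this) hc₀t,
      ENNReal.mul_ne_top hc₀t (ENNReal.mul_ne_top ENNReal.ofReal_ne_top hc₁t)⟩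
  have hmem : ∀ s ∈ Set.Ioo 0 τ, MemLp (fun x => u₁ s x - u₂ s x) 2 := fun s hs =>
    (h₁.memLp_slice hτ hs).sub (h₂.memLp_slice hτ hs)
  refine ⟨K.toReal, ENNReal.toReal_nonneg, hmem, fun s hs a ζ hζ => ?_⟩
  have hsT := Ioo_subset_openTime hτ hs
  have hv₁ := h₁.continuous_slice hsT
  have hv₂ := h₂.continuous_slice hsT
  have hco : ∀ {v : E3 → E3}, Continuous v → ∀ i, Continuous fun x => v x i := fun hv i =>
    (EuclideanSpace.proj (𝕜 := ℝ) i : E3 →L[ℝ] ℝ).continuous.comp hv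
  set P₁ : Fin 3 → Fin 3 → E3 → ℝ := fun i j x =>
    kernelConv k (u₁ s) x j * u₁ s x i - eddyFlux k (A s) (u₁ s) j x i with hP₁
  set P₂ : Fin 3 → Fin 3 → E3 → ℝ := fun i j x =>
    kernelConv k (u₂ s) x j * u₂ s x i - eddyFlux k (A s) (u₂ s) j x i with hP₂
  have hPc : ∀ {v : E3 → E3}, Continuous v → ∀ i j, Continuous fun x =>
      kernelConv k v x j * v x i - eddyFlux k (A s) v j x i := fun hv i j =>
    ((hco (contDiff_kernelConv (n := 1) hk1 hkc hv.locallyIntegrable).continuous j).mul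
      (hco hv i)).sub (hco (contDiff_eddyFlux hk hkc (A s) hv j).continuous i)
  have hPle : ∀ i j, eLpNorm (fun x => P₁ i j x - P₂ i j x) 2 (volume : Measure E3) ≤
      K * eLpNorm (fun x => u₁ s x - u₂ s x) 2 (volume : Measure E3) := by
    intro i j
    refine (eLpNorm_flux_sub_le hk hkc (A s) hv₁ hv₂ (B := B)
      (fun x => (hle₁ s hs x).trans le_self_add) (fun x => (hle₂ s hs x).trans le_add_self)
      i j).trans ?_
    have hAs : ‖A s‖ₑ ≤ ENNReal.ofReal M := by
      rw [← ofReal_norm]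
      exact ENNReal.ofReal_le_ofReal (hM s hs.1.le)
    have hcj : ∫⁻ y, ‖partialD j k y‖ₑ ≤ c₁ :=
      Finset.single_le_sum (f := fun j => ∫⁻ y, ‖partialD j k y‖ₑ) (fun _ _ => zero_le)
        (Finset.mem_univ j)
    rw [hK]
    gcongr
  have hPm : ∀ i j, MemLp (fun x => P₁ i j x - P₂ i j x) 2 := fun i j =>
    ⟨((hPc hv₁ i j).sub (hPc hv₂ i j)).aestronglyMeasurable,
      (hPle i j).trans_lt (ENNReal.mul_lt_top hKt.lt_top (hmem s hs).2)⟩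
  have hPl2 : ∀ i j, l2norm (fun x => P₁ i j x - P₂ i j x) ≤
      K.toReal * l2norm (fun x => u₁ s x - u₂ s x) := fun i j => by
    rw [l2norm, l2norm, ← ENNReal.toReal_mul]
    exact ENNReal.toReal_mono (ENNReal.mul_ne_top hKt (hmem s hs).2.ne) (hPle i j)
  refine ⟨∑ i : Fin 3, ∑ j : Fin 3, pairing (fun x => P₁ i j x - P₂ i j x)
    (∂_{basisVec j} (curlCurl a ζ i)), ?_, ?_⟩
  · rw [gradCurlCurlNorm, Finset.mul_sum]
    refine (norm_sum_le _ _).trans (Finset.sum_le_sum fun i _ => ?_)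
    rw [Finset.mul_sum]
    refine (norm_sum_le _ _).trans (Finset.sum_le_sum fun j _ => ?_)
    exact (norm_pairing_le (hPm i j) _).trans
      (mul_le_mul_of_nonneg_right (hPl2 i j) (norm_nonneg _))
  · have hlap := hasCompactSupport_laplacian hζ
    have hsub : ∀ r ∈ openTime T, pairing (fun x => (u₁ r x - u₂ r x) a) (Δ ζ) =
        pairing (fun x => u₁ r x a) (Δ ζ) - pairing (fun x => u₂ r x a) (Δ ζ) := fun r hr =>
      pairing_fun_sub hlap (hco (h₁.continuous_slice hr) a) (hco (h₂.continuous_slice hr) a)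
    have hsub2 : pairing (fun x => (u₁ s x - u₂ s x) a) (Δ (Δ ζ)) =
        pairing (fun x => u₁ s x a) (Δ (Δ ζ)) - pairing (fun x => u₂ s x a) (Δ (Δ ζ)) :=
      pairing_fun_sub (hasCompactSupport_laplacian hlap) (hco hv₁ a) (hco hv₂ a)
    have hsum : ∑ i : Fin 3, ∑ j : Fin 3, pairing (fun x => P₁ i j x - P₂ i j x)
        (∂_{basisVec j} (curlCurl a ζ i)) =
        ∑ i : Fin 3, ∑ j : Fin 3, pairing (P₁ i j) (∂_{basisVec j} (curlCurl a ζ i)) -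
        ∑ i : Fin 3, ∑ j : Fin 3, pairing (P₂ i j) (∂_{basisVec j} (curlCurl a ζ i)) := by
      rw [← Finset.sum_sub_distrib]
      refine Finset.sum_congr rfl fun i _ => ?_
      rw [← Finset.sum_sub_distrib]
      exact Finset.sum_congr rfl fun j _ => pairing_fun_sub
        (hasCompactSupport_lineDeriv (hasCompactSupport_curlCurl hζ a i) _)
        (hPc hv₁ i j) (hPc hv₂ i j)
    have hd := (h₁.hasDerivAt_pairing_laplacian hρ hε a hζ hsT).sub
      (h₂.hasDerivAt_pairing_laplacian hρ hε a hζ hsT)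
    rw [hsub2, hsum]
    refine (hd.congr_of_eventuallyEq ?_).congr_deriv ?_
    · filter_upwards [(isOpen_openTime T).mem_nhds hsT] with r hr
      exact hsub r hr
    · simp only [hP₁, hP₂]
      ring

lemma tendsto_l2norm_sub (h₁ : IsRegularSolution ν A ρ ε u₀ T u₁ p₁)
    (h₂ : IsRegularSolution ν A ρ ε u₀ T u₂ p₂) (hρ : IsMollifier ρ) (hε : 0 < ε)
    (hu₀ : MemLp u₀ 2 (volume : Measure E3)) {τ : ℝ} (hτ : τ ∈ openTime T) :
    Tendsto (fun s => l2norm fun x => u₁ s x - u₂ s x) (𝓝[>] 0) (𝓝 0) := by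
  have hm : Continuous (mollify ρ ε u₀) :=
    (contDiff_kernelConv (n := 0)
      (contDiff_zero.2 (contDiff_rescale hρ.smooth ε).continuous)
      (hasCompactSupport_rescale hρ.compactSupport hε.ne')
      (hu₀.locallyIntegrable (by norm_num))).continuous
  have hlim : Tendsto (fun s => eLpNorm (fun x => u₁ s x - u₂ s x) 2 (volume : Measure E3))
      (𝓝[>] 0) (𝓝 0) := by
    have hadd := h₁.initial_L2.add h₂.initial_L2
    rw [add_zero] at hadd
    refine tendsto_of_tendsto_of_tendsto_of_le_of_le' tendsto_const_nhds hadd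
      (Eventually.of_forall fun _ => zero_le) ?_
    filter_upwards [Ioo_mem_nhdsGT hτ.1] with s hs
    have hsT := Ioo_subset_openTime hτ hs
    have e : (fun x => u₁ s x - u₂ s x) =
        (fun x => u₁ s x - mollify ρ ε u₀ x) - fun x => u₂ s x - mollify ρ ε u₀ x := by
      funext x
      simp
    rw [e]
    exact eLpNorm_sub_le ((h₁.continuous_slice hsT).sub hm).aestronglyMeasurable
      ((h₂.continuous_slice hsT).sub hm).aestronglyMeasurable (by norm_num)
  have h := (ENNReal.tendsto_toReal ENNReal.zero_ne_top).comp hlim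
  rw [ENNReal.toReal_zero] at h
  exact h

/-- Two regular solutions with the same data have the same velocity. -/
theorem velocity_unique (h₁ : IsRegularSolution ν A ρ ε u₀ T u₁ p₁)
    (h₂ : IsRegularSolution ν A ρ ε u₀ T u₂ p₂) (hν : 0 < ν) (hρ : IsMollifier ρ) (hε : 0 < ε)
    (hA : ∃ M : ℝ, ∀ t : ℝ, 0 ≤ t → ‖A t‖ ≤ M)
    (hu₀ : MemLp u₀ 2 (volume : Measure E3)) {t : ℝ} (ht : t ∈ openTime T) : u₁ t = u₂ t := by
  -- The bounds hold on `[0, τ]` only for `τ < T`, so a real `τ` strictly between `t` and `T` is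
  -- fixed.
  obtain ⟨τ, htτ, hτT⟩ := EReal.lt_iff_exists_real_btwn.1 ht.2
  have htτ' : t < τ := EReal.coe_lt_coe_iff.1 htτ
  have hτ : τ ∈ openTime T := ⟨ht.1.trans htτ', hτT⟩
  obtain ⟨K, hK, hw⟩ := h₁.exists_isWeakEvolution_sub h₂ hρ hε hA hτ
  obtain ⟨C₁, hC₁, hle₁⟩ := h₁.exists_eLpNorm_le hτ
  obtain ⟨C₂, hC₂, hle₂⟩ := h₂.exists_eLpNorm_le hτ
  have hbd : ∀ s ∈ Set.Ioo 0 τ, l2norm (fun x => u₁ s x - u₂ s x) ≤ (C₁ + C₂).toReal := by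
    intro s hs
    have hsT := Ioo_subset_openTime hτ hs
    refine ENNReal.toReal_mono (ENNReal.add_ne_top.2 ⟨hC₁, hC₂⟩) ?_
    exact (eLpNorm_sub_le (h₁.continuous_slice hsT).aestronglyMeasurable
      (h₂.continuous_slice hsT).aestronglyMeasurable (by norm_num)).trans
      (add_le_add (hle₁ s hs) (hle₂ s hs))
  have h0 := hw.l2norm_eq_zero hν hK hbd (h₁.tendsto_l2norm_sub h₂ hρ hε hu₀ hτ) t ⟨ht.1, htτ'⟩
  have hmem := hw.memLp t ⟨ht.1, htτ'⟩
  have h1 : eLpNorm (fun x => u₁ t x - u₂ t x) 2 (volume : Measure E3) = 0 :=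
    ((ENNReal.toReal_eq_zero_iff _).1 h0).resolve_right hmem.2.ne
  have h2 := (eLpNorm_eq_zero_iff hmem.1 two_ne_zero).1 h1
  refine (Continuous.ae_eq_iff_eq (volume : Measure E3) (h₁.continuous_slice ht)
    (h₂.continuous_slice ht)).1 ?_
  filter_upwards [h2] with x hx
  exact sub_eq_zero.1 hx

/-- Two regular solutions with the same data have the same pressure, up to a constant. -/
theorem pressure_unique (h₁ : IsRegularSolution ν A ρ ε u₀ T u₁ p₁)
    (h₂ : IsRegularSolution ν A ρ ε u₀ T u₂ p₂)
    (hu : ∀ t ∈ openTime T, u₁ t = u₂ t) {t : ℝ} (ht : t ∈ openTime T) :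
    ∃ c : ℝ, ∀ x, p₁ t x = p₂ t x + c := by
  have hgrad : ∀ x, gradient (p₁ t) x = gradient (p₂ t) x := by
    intro x
    have e1 := h₁.momentum t ht x
    have e2 := h₂.momentum t ht x
    -- Equality of the velocities at time `t` alone would not suffice here; they agree on a
    -- neighbourhood of `t`.
    have hd : deriv (fun s => u₁ s x) t = deriv (fun s => u₂ s x) t := by
      refine EventuallyEq.deriv_eq ?_
      filter_upwards [(isOpen_openTime T).mem_nhds ht] with s hs
      rw [hu s hs]
    rw [hd, hu t ht] at e1
    exact add_left_cancel (e1.trans e2.symm)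
  have hd₁ := (h₁.contDiff_p t ht).differentiable one_ne_zero
  have hd₂ := (h₂.contDiff_p t ht).differentiable one_ne_zero
  have hf : ∀ x, fderiv ℝ (fun y => p₁ t y - p₂ t y) x = 0 := by
    intro x
    have h3 : fderiv ℝ (fun y => p₁ t y - p₂ t y) x = fderiv ℝ (p₁ t) x - fderiv ℝ (p₂ t) x :=
      fderiv_fun_sub (hd₁ x) (hd₂ x)
    have h4 := hgrad x
    simp only [gradient, EmbeddingLike.apply_eq_iff_eq] at h4
    rw [h3, h4, sub_self]
  refine ⟨p₁ t 0 - p₂ t 0, fun x => ?_⟩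
  have := is_const_of_fderiv_eq_zero (𝕜 := ℝ) (hd₁.sub hd₂) hf x 0
  simp only [Pi.sub_apply] at this
  linarith

end IsRegularSolution

/-- The whole space has infinite volume. -/
lemma eq_zero_of_memLp_const {c : ℝ} (h : MemLp (fun _ : E3 => c) 2 (volume : Measure E3)) :
    c = 0 := by
  rcases (memLp_const_iff two_ne_zero ENNReal.ofNat_ne_top).1 h with h | h
  · exact h
  · rw [measure_univ_of_isAddLeftInvariant] at h
    exact absurd h (lt_irrefl _)

end
end RegNSE

end

theorem mainTheorem4
    (ν : ℝ) (hν : 0 < ν)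
    (ρ : RegNSE.E3 → ℝ) (hρ : RegNSE.IsMollifier ρ)
    (ε : ℝ) (hε : 0 < ε)
    (A : ℝ → Lp ℝ ∞ (volume : Measure RegNSE.E3))
    (hA_cont : ContinuousOn A (Set.Ici 0))
    (hA_bdd : ∃ M : ℝ, ∀ t : ℝ, 0 ≤ t → ‖A t‖ ≤ M)
    (hA_nonneg : ∀ t : ℝ, 0 ≤ t → ∀ᵐ x ∂(volume : Measure RegNSE.E3), 0 ≤ A t x)
    (u₀ : RegNSE.E3 → RegNSE.E3)
    (hu₀ : MemLp u₀ 2 (volume : Measure RegNSE.E3))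
    (hu₀_div : RegNSE.WeakDivFree u₀)
    (T : EReal) (hT : 0 < T)
    (u₁ u₂ : ℝ → RegNSE.E3 → RegNSE.E3) (p₁ p₂ : ℝ → RegNSE.E3 → ℝ)
    (h₁ : RegNSE.IsRegularSolution ν A ρ ε u₀ T u₁ p₁)
    (h₂ : RegNSE.IsRegularSolution ν A ρ ε u₀ T u₂ p₂) :
    (∀ t : ℝ, 0 ≤ t → (t : EReal) < T → ∀ x : RegNSE.E3, u₁ t x = u₂ t x) ∧
    (∀ t ∈ RegNSE.openTime T, ∃ c : ℝ, ∀ x : RegNSE.E3, p₁ t x = p₂ t x + c) ∧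
    (∀ t ∈ RegNSE.openTime T,
      MemLp (p₁ t) 2 (volume : Measure RegNSE.E3) →
      MemLp (p₂ t) 2 (volume : Measure RegNSE.E3) →
      ∀ x : RegNSE.E3, p₁ t x = p₂ t x) := by
  have hu : ∀ t ∈ RegNSE.openTime T, u₁ t = u₂ t := fun t ht =>
    h₁.velocity_unique h₂ hν hρ hε hA_bdd hu₀ ht
  refine ⟨fun t ht htT x => ?_, fun t ht => h₁.pressure_unique h₂ hu ht,
    fun t ht hp₁ hp₂ => ?_⟩
  · rcases ht.eq_or_lt with rfl | ht
    · rw [h₁.initial, h₂.initial]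
    · rw [hu t ⟨ht, htT⟩]
  · obtain ⟨c, hc⟩ := h₁.pressure_unique h₂ hu ht
    have h : MemLp (fun _ : RegNSE.E3 => c) 2 (volume : Measure RegNSE.E3) := by
      have hsub := hp₁.sub hp₂
      have e : p₁ t - p₂ t = fun _ => c := by
        funext x
        rw [Pi.sub_apply, hc x, add_sub_cancel_left]
      rwa [e] at hsub
    intro x
    rw [hc x, RegNSE.eq_zero_of_memLp_const h, add_zero]
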